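/- **Corollary (independence of coorbit spaces from $\theta$).** *Setting.* Let $D=\mathbb R$ or $D=\mathbb R^+=(0,\infty)$. Weights on $\mathbb R$ are measurable functions $\mathbb R\to(0,\infty)$; a weight $v$ is submultiplicative if $v(x+y)\le v(x)v(y)$, and a weight $w$ is $v$-moderate (for a submultiplicative weight $v$) if $w(x+y)\le C v(x)w(y)$ for some constant $C$ and all $x,y$. Let $F:D\to\mathbb R$ be a warping function: a $C^1$ bijection with $F'>0$, with $F'(t_1)\le F'(t_0)$ whenever $|t_0|<|t_1|$, odd if $D=\mathbb R$, and such that $w:=(F^{-1})'$ is $v$-moderate for some submultiplicative weight $v$. Assume that $w\in C^1(\mathbb R)$ and that $$\frac{w(x+y)}{w(x)w(y)}\le C<\infty,\qquad \left|\frac{w'}{w}\right|(x)\le D_1<\infty\qquad\text{for all }x,y\in\mathbb R.$$ Let $m_1:D\to(0,\infty)$ be such that $m_1\circ F^{-1}$ is a $v_1$-moderate weight for a symmetric submultiplicative weight $v_1$, and put, for $(x,\xi),(y,\omega)\in X:=D\times\mathbb R$ (with Lebesgue measure $\mu$), $$m\big((x,\xi),(y,\omega)\big)=\max\left\{\frac{m_1(x)}{m_1(y)},\frac{m_1(y)}{m_1(x)}\right\}.$$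 *Warped systems.* With $\hat f(\xi)=\int f(t)e^{-2\pi i t\xi}\,dt$, let $\mathcal H=\mathcal F^{-1}(L^2(D))\subset L^2(\mathbb R)$. For $\theta:\mathbb R\to\mathbb C$ let $\mathcal G(\theta,F)=\{g_{x,\xi}\}_{(x,\xi)\in X}$, where $g_{x,\xi}=T_\xi\mathcal F^{-1}g_x$, $T_\xi f=f(\cdot-\xi)$, and $g_x(t)=\sqrt{F'(x)}\,\theta(F(t)-F(x))$ for $t\in D$, $g_x(t)=0$ for $t\notin D$. Let $V_\theta f(x,\xi)=\langle f,g_{x,\xi}\rangle$ and $K_{\theta,F}(p,q)=\|\theta\|_{L^2}^{-2}\langle g_q,g_p\rangle$ for $p,q\in X$. *Coorbit spaces.* $\mathcal A_m$ is the space of measurable kernels $K:X\times X\to\mathbb C$ for which $$\|K\|_{\mathcal A_m}=\max\left\{\operatorname*{ess\,sup}_{p}\int_X|K(p,q)|m(p,q)\,d\mu(q),\ \operatorname*{ess\,sup}_{q}\int_X|K(p,q)|m(p,q)\,d\mu(p)\right\}<\infty .$$ Fix $z\in X$ and put $v=m(\cdot,z)$. Let $\mathcal H^1_v(\theta)=\{f\in\mathcal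 H: V_\theta f\in L^1_v\}$ with norm $\|V_\theta f\|_{L^1_v}=\int_X|V_\theta f|\,v\,d\mu$, and let $(\mathcal H^1_v(\theta))^*$ be its anti-dual, the space of continuous conjugate-linear functionals. For $f$ in the anti-dual put $V_\theta f(p)=f(g_p)$. A solid Banach space $Y$ on $X$ is a nontrivial Banach space of (classes of) functions, continuously embedded in $L^1_{loc}(X)$, such that $G\in L^1_{loc}$, $H\in Y$ and $|G|\le|H|$ a.e. imply $G\in Y$ and $\|G\|_Y\le\|H\|_Y$. Suppose that $Y$ is one with $$K(G):=\int_X K(\cdot,q)G(q)\,d\mu(q)\in Y,\qquad \|K(G)\|_Y\le\|K\|_{\mathcal A_m}\|G\|_Y\qquad\text{for all }K\in\mathcal A_m,\ G\in Y \tag{1}$$ (the integral converging for almost every point of $X$). The coorbit space of $Y$ is $$\mathrm{Co}(\mathcal G(\theta,F),Y)=\{f\in(\mathcal H^1_v(\theta))^*: V_\theta f\in Y\},\qquad \|f\|_{\mathrm{Co}}=\|V_\theta f\|_Y .$$ *Assertion.* Let $\theta_1,\theta_2$ be nonzero functions such that either - $\theta_1,\theta_2\in C_c^\infty(\mathbb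 R)$; or - $\theta_1,\theta_2\in\mathcal S(\mathbb R)$, and in addition $w$ and $v_1$ are $\mathcal O((1+|\cdot|)^p)$ for some $p>0$. Then: 1. For $\theta\in\{\theta_1,\theta_2\}$ the coorbit spaces are well defined: every $g_x$ is in $L^2$; $\mathcal G(\theta,F)$ is a continuous tight frame for $\mathcal H$ with frame bound $\|\theta\|_{L^2}^2>0$ (that is, $p\mapsto g_p$ is weakly continuous and $\int_X|V_\theta f|^2d\mu=\|\theta\|_{L^2}^2\|f\|^2$ for all $f\in\mathcal H$); $K_{\theta,F}\in\mathcal A_m$; and $g_p\in\mathcal H^1_v(\theta)$ for all $p\in X$ and all $z\in X$. 2. For every $z\in X$, $\mathcal H^1_v(\theta_1)=\mathcal H^1_v(\theta_2)$ as sets, with equivalent norms, so that the anti-duals agree; and for every solid Banach space $Y$ that satisfies (1), $$\mathrm{Co}(\mathcal G(\theta_1,F),Y)=\mathrm{Co}(\mathcal G(\theta_2,F),Y),$$ as sets of conjugate-linear functionals, with equivalent norms. -/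

import Mathlib

open MeasureTheory Set Filter FourierTransform SchwartzMap Asymptotics
open scoped ENNReal

noncomputable section

namespace WarpedCoorbit

/-! ### Generalized coorbit theory over a measure space `(X, μ)` and a Hilbert space `E` -/

section Abstract

variable {X : Type*} [MeasurableSpace X]
variable {E : Type*} [NormedAddCommGroup E] [InnerProductSpace ℂ E]

/-- `V_Ψ f (x) = ⟨f, ψ_x⟩`, linear in `f` (Mathlib's `inner` is conjugate-linear in its first
argument). -/
def frameTransform (Ψ : X → E) (f : E) (x : X) : ℂ := inner ℂ (Ψ x) f

/-- A continuous tight frame with frame bound `A > 0`. -/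
structure IsContinuousTightFrame [TopologicalSpace X] (μ : Measure X) (Ψ : X → E) (A : ℝ) :
    Prop where
  pos : 0 < A
  weaklyContinuous : ∀ f : E, Continuous (frameTransform Ψ f)
  tight : ∀ f : E, ∫⁻ x, ‖frameTransform Ψ f x‖ₑ ^ 2 ∂μ = ENNReal.ofReal (A * ‖f‖ ^ 2)

/-- `K_Ψ(x,y) = A⁻¹ ⟨ψ_y, ψ_x⟩`. -/
def frameKernel (A : ℝ) (Ψ : X → E) (x y : X) : ℂ := (A : ℂ)⁻¹ * inner ℂ (Ψ x) (Ψ y)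

/-- The norm of the kernel algebra `𝒜₁`, with value `⊤` for kernels outside of it. -/
def kernelNormOne (μ : Measure X) (K : X → X → ℂ) : ℝ≥0∞ :=
  max (essSup (fun x => ∫⁻ y, ‖K x y‖ₑ ∂μ) μ) (essSup (fun y => ∫⁻ x, ‖K x y‖ₑ ∂μ) μ)

/-- The norm of `𝒜_m`: `‖K‖_{𝒜_m} = ‖K m‖_{𝒜₁}`. -/
def kernelNorm (μ : Measure X) (m : X → X → ℝ) (K : X → X → ℂ) : ℝ≥0∞ :=
  kernelNormOne μ (fun x y => K x y * (m x y : ℂ))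

/-- `K ∈ 𝒜_m`. -/
def MemKernelAlgebra (μ : Measure X) (m : X → X → ℝ) (K : X → X → ℂ) : Prop :=
  AEStronglyMeasurable (Function.uncurry K) (μ.prod μ) ∧ kernelNorm μ m K < ⊤

/-- The space `ℋ¹_v = {f ∈ ℋ : V_Ψ f ∈ L¹_v}`, where `G ∈ L¹_v` means `v G ∈ L¹`. -/
def testSpace (μ : Measure X) (v : X → ℝ) (Ψ : X → E) : Submodule ℂ E where
  carrier := {f | Integrable (fun x => (v x : ℂ) * frameTransform Ψ f x) μ}
  add_mem' {f g} hf hg := by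
    have h := Integrable.add hf hg
    refine h.congr (Eventually.of_forall fun x => ?_)
    simp [frameTransform, mul_add]
  zero_mem' := by simp [frameTransform]
  smul_mem' c f hf := by
    have h := Integrable.const_mul hf c
    refine h.congr (Eventually.of_forall fun x => ?_)
    simp only [frameTransform, inner_smul_right]
    ring

/-- The norm `‖f‖_{ℋ¹_v} = ‖V_Ψ f‖_{L¹_v}`. -/
def testNorm (μ : Measure X) (v : X → ℝ) (Ψ : X → E) (f : E) : ℝ :=
  ∫ x, ‖(v x : ℂ) * frameTransform Ψ f x‖ ∂μ

/-- Conjugate-linear functionals on `ℋ¹_v`. -/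
abbrev AntiFunctional (μ : Measure X) (v : X → ℝ) (Ψ : X → E) :=
  testSpace μ v Ψ →ₛₗ[starRingEnd ℂ] ℂ

/-- Continuity of a conjugate-linear functional on `ℋ¹_v`, that is, membership in the
anti-dual `(ℋ¹_v)*`. -/
def MemAntidual (μ : Measure X) (v : X → ℝ) (Ψ : X → E) (f : AntiFunctional μ v Ψ) : Prop :=
  ∃ C : ℝ, ∀ h : testSpace μ v Ψ, ‖f h‖ ≤ C * testNorm μ v Ψ h

open Classical in
/-- The extended transform `V_Ψ f (x) = f(ψ_x)` of `f ∈ (ℋ¹_v)*`. It is only meaningful when all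
`ψ_x` lie in `ℋ¹_v`. -/
def extTransform (μ : Measure X) (v : X → ℝ) (Ψ : X → E) (f : AntiFunctional μ v Ψ) (x : X) : ℂ :=
  if h : Ψ x ∈ testSpace μ v Ψ then f ⟨Ψ x, h⟩ else 0

/-- A solid space of functions on `X`, continuously embedded in `L¹_loc(X, μ)`: a normed space
`Y` together with an injective linear map that realizes its elements as classes of functions.
(It is a solid Banach space when `Y` is complete.) -/
structure SolidSpace [TopologicalSpace X] (μ : Measure X) (Y : Type*) [NormedAddCommGroup Y]
    [NormedSpace ℂ Y] where
  toFun : Y →ₗ[ℂ] (X →ₘ[μ] ℂ)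
  injective : Function.Injective toFun
  /-- continuity of the embedding in `L¹_loc` -/
  locallyIntegrable : ∀ S : Set X, IsCompact S → ∃ C : ℝ, ∀ G : Y,
    IntegrableOn (toFun G) S μ ∧ ∫ x in S, ‖toFun G x‖ ∂μ ≤ C * ‖G‖
  solid : ∀ (G : X →ₘ[μ] ℂ) (H : Y), LocallyIntegrable G μ →
    (∀ᵐ x ∂μ, ‖G x‖ ≤ ‖toFun H x‖) → ∃ G' : Y, toFun G' = G ∧ ‖G'‖ ≤ ‖H‖

section Solid

variable [TopologicalSpace X] {μ : Measure X} {Y : Type*} [NormedAddCommGroup Y]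
  [NormedSpace ℂ Y]

/-- The function `G` belongs to `Y` (up to equality almost everywhere). -/
def SolidSpace.Mem (𝒴 : SolidSpace μ Y) (G : X → ℂ) : Prop := ∃ y : Y, 𝒴.toFun y =ᵐ[μ] G

open Classical in
/-- The norm `‖G‖_Y` of a function in `Y`; the element `y` that represents `G` is unique. -/
def SolidSpace.fnNorm (𝒴 : SolidSpace μ Y) (G : X → ℂ) : ℝ :=
  if h : 𝒴.Mem G then ‖h.choose‖ else 0

/-- `𝒜_m(Y) ⊆ Y` and `‖K(G)‖_Y ≤ ‖K‖_{𝒜_m} ‖G‖_Y`, with `K(G)(x) = ∫ K(x,y) G(y) dμ(y)`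
convergent for almost every `x`. -/
def SolidSpace.IsKernelModule (𝒴 : SolidSpace μ Y) (m : X → X → ℝ) : Prop :=
  ∀ K : X → X → ℂ, MemKernelAlgebra μ m K → ∀ G : Y,
    (∀ᵐ x ∂μ, Integrable (fun y => K x y * 𝒴.toFun G y) μ) ∧
    ∃ G' : Y, 𝒴.toFun G' =ᵐ[μ] (fun x => ∫ y, K x y * 𝒴.toFun G y ∂μ) ∧
      ‖G'‖ ≤ (kernelNorm μ m K).toReal * ‖G‖

/-- The coorbit space `Co(Ψ, Y) = {f ∈ (ℋ¹_v)* : V_Ψ f ∈ Y}`. -/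
def coorbit (v : X → ℝ) (Ψ : X → E) (𝒴 : SolidSpace μ Y) : Set (AntiFunctional μ v Ψ) :=
  {f | MemAntidual μ v Ψ f ∧ 𝒴.Mem (extTransform μ v Ψ f)}

/-- `‖f‖_{Co(Ψ, Y)} = ‖V_Ψ f‖_Y`. -/
def coorbitNorm (v : X → ℝ) (Ψ : X → E) (𝒴 : SolidSpace μ Y) (f : AntiFunctional μ v Ψ) : ℝ :=
  𝒴.fnNorm (extTransform μ v Ψ f)

end Solid

/-- The systems `Ψ₁`, `Ψ₂` generate the same coorbit spaces with respect to the weight `m`. For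
every `z` and `v = m(·, z)`: the spaces `ℋ¹_v` of the two systems coincide as sets and have
equivalent norms, so that they have the same anti-dual; and for every solid Banach space `Y` on
which `𝒜_m` acts, `Co(Ψ₁, Y) = Co(Ψ₂, Y)` as sets of functionals, with equivalent norms. -/
def GenerateSameCoorbits.{u} [TopologicalSpace X] (μ : Measure X) (m : X → X → ℝ)
    (Ψ₁ Ψ₂ : X → E) : Prop :=
  ∀ z : X, ∃ h : testSpace μ (fun x => m x z) Ψ₂ = testSpace μ (fun x => m x z) Ψ₁,
    (∃ C : ℝ, ∀ f ∈ testSpace μ (fun x => m x z) Ψ₁,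
      testNorm μ (fun x => m x z) Ψ₂ f ≤ C * testNorm μ (fun x => m x z) Ψ₁ f ∧
      testNorm μ (fun x => m x z) Ψ₁ f ≤ C * testNorm μ (fun x => m x z) Ψ₂ f) ∧
    ∀ (Y : Type u) [NormedAddCommGroup Y] [NormedSpace ℂ Y] [CompleteSpace Y] [Nontrivial Y]
      (𝒴 : SolidSpace μ Y), 𝒴.IsKernelModule m →
      (∀ f : AntiFunctional μ (fun x => m x z) Ψ₁,
        f ∈ coorbit (fun x => m x z) Ψ₁ 𝒴 ↔
          f.comp (Submodule.inclusion h.le) ∈ coorbit (fun x => m x z) Ψ₂ 𝒴) ∧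
      ∃ C : ℝ, ∀ f ∈ coorbit (fun x => m x z) Ψ₁ 𝒴,
        coorbitNorm (fun x => m x z) Ψ₂ 𝒴 (f.comp (Submodule.inclusion h.le)) ≤
          C * coorbitNorm (fun x => m x z) Ψ₁ 𝒴 f ∧
        coorbitNorm (fun x => m x z) Ψ₁ 𝒴 f ≤
          C * coorbitNorm (fun x => m x z) Ψ₂ 𝒴 (f.comp (Submodule.inclusion h.le))

end Abstract

/-! ### Weights and warping functions -/

/-- A (measurable) weight function `ℝ → ℝ⁺`. -/
def IsWeight (w : ℝ → ℝ) : Prop := Measurable w ∧ ∀ x, 0 < w x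

def IsSubmultiplicative (v : ℝ → ℝ) : Prop := IsWeight v ∧ ∀ x y, v (x + y) ≤ v x * v y

/-- `w` is `v`-moderate, for the submultiplicative weight `v`. -/
def IsModerate (v w : ℝ → ℝ) : Prop :=
  IsSubmultiplicative v ∧ IsWeight w ∧ ∃ C : ℝ, ∀ x y, w (x + y) ≤ C * v x * w y

/-- The inverse `F⁻¹ : ℝ → D` of a bijection `F : D → ℝ`. -/
def warpInv (D : Set ℝ) (F : ℝ → ℝ) : ℝ → ℝ := Function.invFunOn F D

/-- `w = (F⁻¹)'`. -/
def warpWeight (D : Set ℝ) (F : ℝ → ℝ) : ℝ → ℝ := deriv (warpInv D F)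

/-- Warping functions `F : D → ℝ`, for `D = ℝ` or `D = ℝ⁺` (the values of `F` outside `D` play
no role). -/
structure IsWarpingFunction (D : Set ℝ) (F : ℝ → ℝ) : Prop where
  domain : D = univ ∨ D = Ioi 0
  bijOn : BijOn F D univ
  contDiffOn : ContDiffOn ℝ 1 F D
  deriv_pos : ∀ t ∈ D, 0 < deriv F t
  deriv_anti : ∀ t₀ ∈ D, ∀ t₁ ∈ D, |t₀| < |t₁| → deriv F t₁ ≤ deriv F t₀
  moderate : ∃ v : ℝ → ℝ, IsModerate v (warpWeight D F)
  odd : D = univ → ∀ t, F (-t) = -F t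

/-! ### Warped time-frequency systems -/

/-- The Hilbert space `L²(ℝ)`. -/
abbrev L2R := Lp ℂ 2 (volume : Measure ℝ)

/-- The translation `T_ξ f = f(· - ξ)` on `L²(ℝ)`. -/
def translate (ξ : ℝ) : L2R →ₗᵢ[ℂ] L2R :=
  Lp.compMeasurePreservingₗᵢ ℂ (fun t : ℝ => t - ξ) (measurePreserving_sub_right volume ξ)

/-- `ℱ⁻¹(L²(D))`: the square-integrable functions whose Fourier transform vanishes outside `D`. -/
def fourierL2 (D : Set ℝ) : Submodule ℂ L2R where
  carrier := {f | ∀ᵐ t, t ∉ D → (𝓕 f : L2R) t = 0}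
  add_mem' {f g} hf hg := by
    have h : (𝓕 (f + g) : L2R) = 𝓕 f + 𝓕 g := FourierTransform.fourier_add f g
    have hfg : ∀ᵐ t, t ∉ D → (𝓕 (f + g) : L2R) t = 0 := by
      rw [h]
      filter_upwards [hf, hg, Lp.coeFn_add (𝓕 f : L2R) (𝓕 g)] with t h1 h2 h3 ht
      rw [h3, Pi.add_apply, h1 ht, h2 ht, add_zero]
    exact hfg
  zero_mem' := by
    have h : (𝓕 (0 : L2R) : L2R) = 0 := (Lp.fourierTransformₗᵢ ℝ ℂ).map_zero
    have h0 : ∀ᵐ t, t ∉ D → (𝓕 (0 : L2R) : L2R) t = 0 := by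
      rw [h]
      filter_upwards [Lp.coeFn_zero ℂ 2 (volume : Measure ℝ)] with t h1 _
      rw [h1, Pi.zero_apply]
    exact h0
  smul_mem' c f hf := by
    have h : (𝓕 (c • f) : L2R) = c • 𝓕 f := FourierTransform.fourier_smul c f
    have hc : ∀ᵐ t, t ∉ D → (𝓕 (c • f) : L2R) t = 0 := by
      rw [h]
      filter_upwards [hf, Lp.coeFn_smul c (𝓕 f : L2R)] with t h1 h3 ht
      rw [h3, Pi.smul_apply, h1 ht, smul_zero]
    exact hc

/-- The character `t ↦ e^{-2πiξt}`. -/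
def character (ξ t : ℝ) : ℂ := (Real.fourierChar (-(ξ * t)) : ℂ)

theorem continuous_character (ξ : ℝ) : Continuous (character ξ) := by
  unfold character
  fun_prop

theorem memLp_character (ξ : ℝ) : MemLp (character ξ) ⊤ (volume : Measure ℝ) :=
  memLp_top_of_bound (continuous_character ξ).aestronglyMeasurable 1
    (Eventually.of_forall fun _ => (Circle.norm_coe _).le)

/-- `ℱ T_ξ f = e^{-2πiξ·} ℱ f` on `L²(ℝ)`. -/
theorem fourier_translate (ξ : ℝ) (f : L2R) :
    (𝓕 (translate ξ f) : L2R) = (ContinuousLinearMap.mul ℂ ℂ).holderL volume ⊤ 2 2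
      ((memLp_character ξ).toLp _) (𝓕 f : L2R) := by
  apply DenseRange.induction_on
    (p := fun f : L2R => (𝓕 (translate ξ f) : L2R) =
      (ContinuousLinearMap.mul ℂ ℂ).holderL volume ⊤ 2 2
      ((memLp_character ξ).toLp _) (𝓕 f : L2R))
    (SchwartzMap.denseRange_toLpCLM (E := ℝ) (F := ℂ) (p := 2) (μ := volume)
      ENNReal.ofNat_ne_top) f
  · apply isClosed_eq
    · exact (Lp.fourierTransformₗᵢ ℝ ℂ).continuous.comp (translate ξ).continuous
    · exact (ContinuousLinearMap.continuous _).comp (Lp.fourierTransformₗᵢ ℝ ℂ).continuous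
  intro g
  have h1 : translate ξ (g.toLp 2) = (g.compSubConstCLM ℂ ξ).toLp 2 := by
    apply Lp.ext
    have e1 := Lp.coeFn_compMeasurePreserving (g.toLp 2 : L2R)
      (measurePreserving_sub_right volume ξ)
    have e2 := (measurePreserving_sub_right volume ξ).quasiMeasurePreserving.ae
      (g.coeFn_toLp 2 volume)
    filter_upwards [e1, e2, (g.compSubConstCLM ℂ ξ).coeFn_toLp 2 volume] with t h1 h2 h3
    rw [h3, SchwartzMap.compSubConstCLM_apply, ← h2]
    exact h1
  simp only [SchwartzMap.toLpCLM_apply]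
  rw [h1, SchwartzMap.toLp_fourier_eq, SchwartzMap.toLp_fourier_eq]
  apply Lp.ext
  have e1 := (ContinuousLinearMap.mul ℂ ℂ).coeFn_holder (r := 2)
    ((memLp_character ξ).toLp (character ξ)) ((𝓕 g).toLp 2 volume)
  filter_upwards [e1, (memLp_character ξ).coeFn_toLp, (𝓕 g).coeFn_toLp 2 volume,
    (𝓕 (g.compSubConstCLM ℂ ξ)).coeFn_toLp 2 volume] with t h1 h2 h3 h4
  rw [h4, ContinuousLinearMap.holderL_apply_apply, h1, h2, h3, SchwartzMap.fourier_coe,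
    SchwartzMap.fourier_coe]
  have hc : (⇑(g.compSubConstCLM ℂ ξ) : ℝ → ℂ) = ⇑g ∘ fun v => v + (-ξ) := by
    ext v
    simp [sub_eq_add_neg]
  have h := congrFun (VectorFourier.fourierIntegral_comp_add_right Real.fourierChar volume
    (innerₗ ℝ) (⇑g) (-ξ)) t
  rw [hc]
  refine Eq.trans h ?_
  simp [character, Circle.smul_def, mul_comm]
  rfl

theorem translate_mem_fourierL2 {D : Set ℝ} (ξ : ℝ) {f : L2R} (hf : f ∈ fourierL2 D) :
    translate ξ f ∈ fourierL2 D := by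
  have hf' : ∀ᵐ t, t ∉ D → (𝓕 f : L2R) t = 0 := hf
  have h : ∀ᵐ t, t ∉ D → (𝓕 (translate ξ f) : L2R) t = 0 := by
    rw [fourier_translate]
    filter_upwards [hf', (ContinuousLinearMap.mul ℂ ℂ).coeFn_holder (r := 2)
      ((memLp_character ξ).toLp (character ξ)) (𝓕 f : L2R)] with t h1 h2 ht
    rw [ContinuousLinearMap.holderL_apply_apply, h2, h1 ht]
    simp
  exact h

/-- `g_x = √F'(x) (T_{F(x)} θ) ∘ F` on `D`, extended by zero to `ℝ`. -/
def warpedProfile (D : Set ℝ) (F : ℝ → ℝ) (θ : ℝ → ℂ) (x : ℝ) : ℝ → ℂ :=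
  D.indicator fun t => ((√(deriv F x) : ℝ) : ℂ) * θ (F t - F x)

open Classical in
/-- `g_x` as an element of `L²(ℝ)`. -/
def warpedProfileL2 (D : Set ℝ) (F : ℝ → ℝ) (θ : ℝ → ℂ) (x : ℝ) : L2R :=
  if h : MemLp (warpedProfile D F θ x) 2 volume then h.toLp _ else 0

theorem fourierInv_warpedProfileL2_mem (D : Set ℝ) (F : ℝ → ℝ) (θ : ℝ → ℂ) (x : ℝ) :
    (𝓕⁻ (warpedProfileL2 D F θ x) : L2R) ∈ fourierL2 D := by
  have hF : (𝓕 (𝓕⁻ (warpedProfileL2 D F θ x) : L2R) : L2R) = warpedProfileL2 D F θ x :=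
    FourierTransform.fourier_fourierInv_eq _
  have h : ∀ᵐ t, t ∉ D → (𝓕 (𝓕⁻ (warpedProfileL2 D F θ x) : L2R) : L2R) t = 0 := by
    rw [hF]
    unfold warpedProfileL2
    split_ifs with hm
    · filter_upwards [hm.coeFn_toLp] with t h1 ht
      rw [h1, warpedProfile, Set.indicator_of_notMem ht]
    · filter_upwards [Lp.coeFn_zero ℂ 2 (volume : Measure ℝ)] with t h1 _
      rw [h1, Pi.zero_apply]
  exact h

/-- The phase space `D × ℝ`. -/
abbrev PhaseSpace (D : Set ℝ) := D × ℝ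

/-- Lebesgue measure on the phase space. -/
def phaseMeasure (D : Set ℝ) : Measure (PhaseSpace D) :=
  ((volume : Measure ℝ).comap ((↑) : D → ℝ)).prod volume

/-- The warped time-frequency system `𝒢(θ, F) = {g_{x,ξ} = T_ξ ℱ⁻¹ g_x}` in `ℱ⁻¹(L²(D))`. -/
def warpedSystem (D : Set ℝ) (F : ℝ → ℝ) (θ : ℝ → ℂ) (p : PhaseSpace D) : fourierL2 D :=
  ⟨translate p.2 (𝓕⁻ (warpedProfileL2 D F θ p.1) : L2R),
    translate_mem_fourierL2 p.2 (fourierInv_warpedProfileL2_mem D F θ p.1)⟩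

/-- The weight `m(x, y, ξ, ω) = max {m₁(x)/m₁(y), m₁(y)/m₁(x)}` on pairs `((x, ξ), (y, ω))`. -/
def ratioWeight {D : Set ℝ} (m₁ : ℝ → ℝ) (p q : PhaseSpace D) : ℝ :=
  max (m₁ p.1 / m₁ q.1) (m₁ q.1 / m₁ p.1)

/-- The system `𝒢(θ, F)` admits the construction of coorbit spaces for the weight `m`: its
members are square-integrable, it is a continuous tight frame with bound `‖θ‖²`, its kernel
`K_{θ,F}` lies in `𝒜_m`, and its members lie in `ℋ¹_v`, `v = m(·, z)`, for every `z`. -/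
structure AdmitsCoorbits (D : Set ℝ) (F : ℝ → ℝ) (m : PhaseSpace D → PhaseSpace D → ℝ)
    (θ : ℝ → ℂ) : Prop where
  memLp : ∀ x ∈ D, MemLp (warpedProfile D F θ x) 2 volume
  frame : IsContinuousTightFrame (phaseMeasure D) (warpedSystem D F θ) (∫ s, ‖θ s‖ ^ 2)
  kernel : MemKernelAlgebra (phaseMeasure D) m
    (frameKernel (∫ s, ‖θ s‖ ^ 2) (warpedSystem D F θ))
  mem_testSpace : ∀ z p, warpedSystem D F θ p ∈
    testSpace (phaseMeasure D) (fun q => m q z) (warpedSystem D F θ)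

/-- `f` grows at most polynomially: `f ∈ 𝒪((1 + |·|)^p)` for some `p > 0`. -/
def PolynomialGrowth (f : ℝ → ℝ) : Prop :=
  ∃ p : ℝ, 0 < p ∧ f =O[cocompact ℝ] fun x => (1 + |x|) ^ p

/-- `θ ∈ C_c^∞(ℝ)`. -/
def IsTestFunction (θ : ℝ → ℂ) : Prop := ContDiff ℝ (⊤ : ℕ∞) θ ∧ HasCompactSupport θ

/-- `θ ∈ 𝒮(ℝ)`. -/
def IsSchwartz (θ : ℝ → ℂ) : Prop := ∃ φ : 𝓢(ℝ, ℂ), ⇑φ = θ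

end WarpedCoorbit

end

noncomputable section

namespace WarpedCoorbit

/-! ### Plancherel's theorem on `L¹ ∩ L²` -/

/-! The argument separates into an abstract transfer principle and a kernel estimate.

Let `Ψ` be a tight frame with bound `A`. Polarization gives `V_Φ f (y) = A⁻¹ ∫ ⟨ψ_x, φ_y⟩ V_Ψ f (x)
dμ(x)` on the Hilbert space, so passing from one system to another is an integral operator with the
mixed Gramian as kernel. If all four Gramians of two tight frames have uniformly bounded
`m`-weighted rows, submultiplicativity of `m` makes this operator bounded on `L¹_v`, and the two
test spaces agree. For functionals in the anti-dual the same formula is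
`MemAntidual.apply_eq_integral`: the reproducing formula is a Bochner integral in `L¹`, to which a
Hahn-Banach extension of the functional applies. The assumption that `𝒜_m` acts on `Y` then
transports `V_Ψ f ∈ Y` to `V_Φ f ∈ Y`; this is `generateSameCoorbits_of_hasFiniteRows`.

For warped systems the substitution `t = F⁻¹(s)` turns the Gramian, with `a = F(x)`, `b = F(y)`, `η
= ξ - ω`, into `(w(a) w(b))^{-1/2} ∫ conj θ₁(s - a) θ₂(s - b) w(s) e^{2πiηF⁻¹(s)} ds`. The phase has
derivative `2πη w(s)`. A first integration by parts absorbs the factor `w` already present, a second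
one divides by `w` once, so two powers of `η` are gained at the cost of a single derivative of `w`.
Since `w(s)` and `w(a)` are comparable up to a factor in `s - a`, the decay is `(1 + (w(a)η)²)⁻¹`.
Its integral over `η` is `π / w(a)`, which compensates the size `w(a)` of the oscillatory integral.
The remaining weights in `b - a` split into weights in `s - a` and `s - b`, so the rest is a
convolution of two weighted windows (`WarpBounds.lintegral_productBound_le`). The two hypotheses on
the windows serve only to make these weighted windows integrable. -/

theorem fourier_toLp_ae_eq {h : ℝ → ℂ} (h1 : Integrable h) (h2 : MemLp h 2 volume) :
    ((𝓕 (h2.toLp h) : L2R) : ℝ → ℂ) =ᵐ[volume] 𝓕 h := by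
  have hcont : Continuous (𝓕 h) :=
    VectorFourier.fourierIntegral_continuous Real.continuous_fourierChar
      (by exact continuous_inner) h1
  apply ae_eq_of_integral_contDiff_smul_eq
  · exact (Lp.memLp _).locallyIntegrable (by norm_num)
  · exact hcont.locallyIntegrable
  -- Tested against a smooth compactly supported `g`, the Fourier transform moves onto `g` on both
  -- sides: by its distributional definition for the `L²` transform, by Fubini for the integral
  -- transform.
  · intro g g_smooth g_cpt
    have hg₁ : HasCompactSupport (Complex.ofRealCLM ∘ g) := g_cpt.comp_left rfl
    have hg₂ : ContDiff ℝ (⊤ : ℕ∞) (Complex.ofRealCLM ∘ g) := by fun_prop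
    set φ : 𝓢(ℝ, ℂ) := hg₁.toSchwartzMap hg₂ with hφ
    have hφg : ∀ x, φ x = (g x : ℂ) := fun x => rfl
    have e1 := congrArg (fun T => T φ) (Lp.fourier_toTemperedDistribution_eq (h2.toLp h))
    simp only [TemperedDistribution.fourier_apply, Lp.toTemperedDistribution_apply] at e1
    have e2 : ∫ x, g x • (𝓕 (h2.toLp h) : L2R) x = ∫ x, φ x • (𝓕 (h2.toLp h) : L2R) x := by
      simp [hφg]
    rw [e2, ← e1]
    have e3 : ∫ x, (𝓕 φ) x • (h2.toLp h) x = ∫ x, (𝓕 φ) x • h x := by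
      apply integral_congr_ae
      filter_upwards [h2.coeFn_toLp] with x hx
      rw [hx]
    rw [e3]
    have e4 := VectorFourier.integral_fourierIntegral_smul_eq_flip (L := innerₗ ℝ)
      Real.continuous_fourierChar (by exact continuous_inner) (φ.integrable (μ := volume)) h1
    rw [flip_innerₗ] at e4
    rw [SchwartzMap.fourier_coe]
    refine Eq.trans e4 ?_
    exact integral_congr_ae (Eventually.of_forall fun x => by
      simp only [hφg, Complex.real_smul, smul_eq_mul]; rfl)

theorem lintegral_enorm_sq_eq_norm (f : L2R) :
    ∫⁻ t, ‖f t‖ₑ ^ 2 = ENNReal.ofReal (‖f‖ ^ 2) := by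
  have h := Lp.enorm_def f
  rw [eLpNorm_eq_lintegral_rpow_enorm_toReal (by norm_num) (by norm_num)] at h
  rw [ENNReal.ofReal_pow (norm_nonneg _), ofReal_norm, h, ← ENNReal.rpow_natCast,
    ← ENNReal.rpow_mul]
  simp

theorem lintegral_enorm_fourier_sq {h : ℝ → ℂ} (h1 : Integrable h) (h2 : MemLp h 2 volume) :
    ∫⁻ ξ, ‖𝓕 h ξ‖ₑ ^ 2 = ∫⁻ t, ‖h t‖ₑ ^ 2 := by
  calc ∫⁻ ξ, ‖𝓕 h ξ‖ₑ ^ 2 = ∫⁻ ξ, ‖(𝓕 (h2.toLp h) : L2R) ξ‖ₑ ^ 2 := by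
        apply lintegral_congr_ae
        filter_upwards [fourier_toLp_ae_eq h1 h2] with x hx
        rw [hx]
    _ = ∫⁻ t, ‖(h2.toLp h : L2R) t‖ₑ ^ 2 := by
        rw [lintegral_enorm_sq_eq_norm, lintegral_enorm_sq_eq_norm, Lp.norm_fourier_eq]
    _ = _ := by
        apply lintegral_congr_ae
        filter_upwards [h2.coeFn_toLp] with x hx
        rw [hx]

/-! ### Integration of kernels in `L¹` -/

/-- By the Lindelöf property every open set is a countable union of balls, and preimages of balls
are sublevel sets of the distance functions. -/
theorem measurable_of_measurable_dist {α β : Type*} [MeasurableSpace α] [PseudoMetricSpace β]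
    [SecondCountableTopology β] [MeasurableSpace β] [BorelSpace β] {f : α → β}
    (h : ∀ b, Measurable fun a => dist (f a) b) : Measurable f := by
  refine measurable_of_isOpen fun U hU => ?_
  have hball : ∀ x : U, ∃ r > 0, Metric.ball (x : β) r ⊆ U := fun x =>
    Metric.isOpen_iff.1 hU x x.2
  choose r hr hrU using hball
  obtain ⟨T, hT, hTU⟩ := TopologicalSpace.isOpen_iUnion_countable
    (fun x : U => Metric.ball (x : β) (r x)) fun x => Metric.isOpen_ball
  have hU' : U = ⋃ x ∈ T, Metric.ball (x : β) (r x) := by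
    rw [hTU]
    apply Subset.antisymm
    · exact fun x hx => mem_iUnion.2 ⟨⟨x, hx⟩, Metric.mem_ball_self (hr _)⟩
    · exact iUnion_subset hrU
  rw [hU']
  simp only [preimage_iUnion]
  exact MeasurableSet.biUnion hT fun x _ => measurableSet_lt (h x) measurable_const

section KernelL1

variable {X : Type*} [MeasurableSpace X] {μ : Measure X} [SFinite μ] [IsSeparable μ]

/-- Distances to a fixed element of `L¹` are parameter integrals, hence measurable in `x`;
separability of `μ` makes `L¹` second countable, so this suffices. -/
theorem stronglyMeasurable_toL1 {k : X → X → ℂ} (hk : Measurable (Function.uncurry k))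
    (hki : ∀ x, Integrable (k x) μ) : StronglyMeasurable fun x => (hki x).toL1 (k x) := by
  borelize ↥(Lp ℂ 1 μ)
  have : Fact ((1 : ℝ≥0∞) ≠ ⊤) := ⟨ENNReal.one_ne_top⟩
  apply Measurable.stronglyMeasurable
  apply measurable_of_measurable_dist
  intro g
  have e : (fun x => dist ((hki x).toL1 (k x)) g) =
      fun x => ∫ y, ‖k x y - g y‖ ∂μ := by
    ext x
    rw [dist_eq_norm, L1.norm_eq_integral_norm]
    apply integral_congr_ae
    filter_upwards [Lp.coeFn_sub ((hki x).toL1 (k x)) g, (hki x).coeFn_toL1] with y h1 h2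
    rw [h1, Pi.sub_apply, h2]
  rw [e]
  refine StronglyMeasurable.measurable (StronglyMeasurable.integral_prod_right'
    (f := fun p : X × X => ‖k p.1 p.2 - g p.2‖) ?_)
  exact (hk.sub
    ((Lp.stronglyMeasurable g).measurable.comp measurable_snd)).norm.stronglyMeasurable

/-- Bochner integrals in `L¹` can be computed pointwise: integration over a set is a continuous
functional on `L¹`, it commutes with the Bochner integral, and Fubini identifies the outcome. -/
theorem integral_smul_toL1_ae_eq {k : X → X → ℂ} (hk : Measurable (Function.uncurry k))
    (hki : ∀ x, Integrable (k x) μ) {c : X → ℂ} (hc : Measurable c)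
    (hck : Integrable (fun p : X × X => c p.1 * k p.1 p.2) (μ.prod μ)) :
    Integrable (fun x => c x • (hki x).toL1 (k x)) μ ∧
    ((∫ x, c x • (hki x).toL1 (k x) ∂μ : Lp ℂ 1 μ) : X → ℂ) =ᵐ[μ]
      fun y => ∫ x, c x * k x y ∂μ := by
  have hint : Integrable (fun x => c x • (hki x).toL1 (k x)) μ := by
    refine ⟨(hc.stronglyMeasurable.smul (stronglyMeasurable_toL1 hk hki)).aestronglyMeasurable, ?_⟩
    rw [← hasFiniteIntegral_norm_iff]
    refine hck.integral_norm_prod_left.2.congr (Eventually.of_forall fun x => ?_)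
    simp only [norm_mul, norm_smul, integral_const_mul]
    congr 1
    rw [L1.norm_eq_integral_norm]
    apply integral_congr_ae
    filter_upwards [(hki x).coeFn_toL1] with y h
    rw [h]
  refine ⟨hint, ?_⟩
  have hR : Integrable (fun y => ∫ x, c x * k x y ∂μ) μ :=
    hck.swap.integral_prod_left
  refine Integrable.ae_eq_of_forall_setIntegral_eq _ _ (L1.integrable_coeFn _) hR ?_
  intro s hs _
  set Φ : Lp ℂ 1 μ →L[ℝ] ℂ := L1.integralCLM ∘L LpToLpRestrictCLM X ℂ ℝ μ 1 s with hΦ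
  have hΦ' : ∀ f : Lp ℂ 1 μ, Φ f = ∫ y in s, f y ∂μ := fun f => by
    rw [hΦ, ContinuousLinearMap.comp_apply, ← L1.integral_eq, L1.integral_eq_integral]
    exact integral_congr_ae (LpToLpRestrictCLM_coeFn ℝ s f)
  rw [← hΦ', ← Φ.integral_comp_comm hint]
  have e1 : ∀ x, Φ (c x • (hki x).toL1 (k x)) = ∫ y in s, c x * k x y ∂μ := fun x => by
    rw [hΦ']
    apply integral_congr_ae
    filter_upwards [ae_restrict_of_ae (Lp.coeFn_smul (c x) ((hki x).toL1 (k x))),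
      ae_restrict_of_ae (hki x).coeFn_toL1] with y h1 h2
    rw [h1, Pi.smul_apply, h2, smul_eq_mul]
  simp only [e1]
  refine integral_integral_swap (μ := μ) (ν := μ.restrict s)
    (f := fun x y => c x * k x y) ?_
  refine hck.mono_measure ?_
  exact Measure.prod_mono le_rfl Measure.restrict_le_self

end KernelL1

/-! ### Change of the analyzing system in generalized coorbit theory -/

/-- A symmetric, submultiplicative, measurable weight on `X × X`. -/
structure IsKernelWeight {X : Type*} [MeasurableSpace X] (m : X → X → ℝ) : Prop where
  pos : ∀ x y, 0 < m x y
  symm : ∀ x y, m x y = m y x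
  le_mul : ∀ x y z, m x z ≤ m x y * m y z
  measurable : ∀ z, Measurable fun x => m x z

/-- The mixed kernel `⟨φ_y, ψ_x⟩` has uniformly bounded weighted row integrals. -/
def HasFiniteRows {X E : Type*} [MeasurableSpace X] [NormedAddCommGroup E] [InnerProductSpace ℂ E]
    (μ : Measure X) (m : X → X → ℝ) (Ψ Φ : X → E) : Prop :=
  ∃ B : ℝ≥0∞, B ≠ ⊤ ∧ ∀ x, ∫⁻ y, ‖(inner ℂ (Ψ x) (Φ y) : ℂ)‖ₑ * ENNReal.ofReal (m x y) ∂μ ≤ B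

/-! ### The test space as a subspace of weighted `L¹` -/

section TestSpace

variable {X : Type*} [MeasurableSpace X]
variable {E : Type*} [NormedAddCommGroup E] [InnerProductSpace ℂ E]
variable {μ : Measure X} {m : X → X → ℝ} {Ψ Φ : X → E} {A : ℝ}

theorem enorm_complex_ofReal (r : ℝ) : ‖(r : ℂ)‖ₑ = ‖r‖ₑ := by
  rw [← ofReal_norm, Complex.norm_real, ofReal_norm]

theorem enorm_inner_symm (f g : E) : ‖(inner ℂ f g : ℂ)‖ₑ = ‖(inner ℂ g f : ℂ)‖ₑ := by
  rw [← ofReal_norm, norm_inner_symm, ofReal_norm]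

theorem integrable_of_mem_testSpace {v : X → ℝ} {f : E} (hf : f ∈ testSpace μ v Ψ) :
    Integrable (fun x => (v x : ℂ) * frameTransform Ψ f x) μ := hf

theorem ofReal_testNorm {v : X → ℝ} {f : E} (hf : f ∈ testSpace μ v Ψ) :
    ENNReal.ofReal (testNorm μ v Ψ f) = ∫⁻ x, ‖v x‖ₑ * ‖frameTransform Ψ f x‖ₑ ∂μ := by
  rw [testNorm, ofReal_integral_norm_eq_lintegral_enorm (integrable_of_mem_testSpace hf)]
  simp [enorm_mul, enorm_complex_ofReal]

theorem testNorm_nonneg (v : X → ℝ) (f : E) : 0 ≤ testNorm μ v Ψ f :=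
  integral_nonneg fun _ => norm_nonneg _

/-- Uses `m(y,z) ≤ m(x,y) m(x,z)`. The bound is linear in `m(x,z)`, which is exactly the weight
available when `x` is integrated afterwards. -/
theorem HasFiniteRows.lintegral_testWeight_le (hm : IsKernelWeight m) {B : ℝ≥0∞} {x : X}
    (hB : ∫⁻ y, ‖(inner ℂ (Ψ x) (Φ y) : ℂ)‖ₑ * ENNReal.ofReal (m x y) ∂μ ≤ B) (z : X) :
    ∫⁻ y, ‖m y z‖ₑ * ‖(inner ℂ (Φ y) (Ψ x) : ℂ)‖ₑ ∂μ ≤ B * ‖m x z‖ₑ := by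
  calc ∫⁻ y, ‖m y z‖ₑ * ‖(inner ℂ (Φ y) (Ψ x) : ℂ)‖ₑ ∂μ
      ≤ ∫⁻ y, (‖(inner ℂ (Ψ x) (Φ y) : ℂ)‖ₑ * ENNReal.ofReal (m x y)) * ‖m x z‖ₑ ∂μ := by
        apply lintegral_mono
        intro y
        have h1 : ‖(inner ℂ (Φ y) (Ψ x) : ℂ)‖ₑ = ‖(inner ℂ (Ψ x) (Φ y) : ℂ)‖ₑ :=
          enorm_inner_symm _ _
        have h2 : ‖m y z‖ₑ ≤ ENNReal.ofReal (m x y) * ‖m x z‖ₑ := by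
          rw [Real.enorm_of_nonneg (hm.pos _ _).le, Real.enorm_of_nonneg (hm.pos _ _).le,
            ← ENNReal.ofReal_mul (hm.pos _ _).le, hm.symm x y]
          exact ENNReal.ofReal_le_ofReal (hm.le_mul _ _ _)
        calc ‖m y z‖ₑ * ‖(inner ℂ (Φ y) (Ψ x) : ℂ)‖ₑ
            ≤ (ENNReal.ofReal (m x y) * ‖m x z‖ₑ) * ‖(inner ℂ (Ψ x) (Φ y) : ℂ)‖ₑ := by
              rw [h1]; gcongr
          _ = _ := by ring
    _ = (∫⁻ y, ‖(inner ℂ (Ψ x) (Φ y) : ℂ)‖ₑ * ENNReal.ofReal (m x y) ∂μ) * ‖m x z‖ₑ :=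
        lintegral_mul_const' _ _ (by simp)
    _ ≤ _ := by gcongr

/-- The isometric embedding `h ↦ v V_Ψ h` of the test space into `L¹`. -/
def testSpaceToL1 (μ : Measure X) (v : X → ℝ) (Ψ : X → E) : testSpace μ v Ψ →ₗ[ℂ] Lp ℂ 1 μ where
  toFun h := Integrable.toL1 (fun x => (v x : ℂ) * frameTransform Ψ h x)
    (integrable_of_mem_testSpace h.2)
  map_add' f g := by
    rw [← Integrable.toL1_add _ _ (integrable_of_mem_testSpace f.2)
      (integrable_of_mem_testSpace g.2)]
    exact (Integrable.toL1_eq_toL1_iff _ _ _ _).2 (Eventually.of_forall fun x => by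
      simp [frameTransform, mul_add])
  map_smul' c f := by
    rw [RingHom.id_apply, ← Integrable.toL1_smul _ (integrable_of_mem_testSpace f.2)]
    exact (Integrable.toL1_eq_toL1_iff _ _ _ _).2 (Eventually.of_forall fun x => by
      simp only [frameTransform, Submodule.coe_smul, inner_smul_right, smul_eq_mul]
      ring)

theorem norm_testSpaceToL1 (v : X → ℝ) (h : testSpace μ v Ψ) :
    ‖testSpaceToL1 μ v Ψ h‖ = testNorm μ v Ψ h := by
  rw [L1.norm_eq_integral_norm, testNorm]
  apply integral_congr_ae
  filter_upwards [Integrable.coeFn_toL1 (f := fun x => (v x : ℂ) * frameTransform Ψ h x)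
    (integrable_of_mem_testSpace h.2)]
    with x hx
  rw [← hx]
  rfl

/-- A continuous conjugate-linear functional on the test space extends to `L¹`. -/
theorem MemAntidual.exists_extension {v : X → ℝ} {f : AntiFunctional μ v Ψ}
    (hf : MemAntidual μ v Ψ f) :
    ∃ g : Lp ℂ 1 μ →L[ℂ] ℂ, ∀ h, g (testSpaceToL1 μ v Ψ h) = (starRingEnd ℂ) (f h) := by
  obtain ⟨C, hC⟩ := hf
  set J := testSpaceToL1 μ v Ψ with hJ
  -- Conjugation makes the functional linear, so that Hahn-Banach applies. Injectivity of `J` is not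
  -- assumed; the bound makes `f'` vanish on its kernel, and `f'` descends to the range.
  set f' : testSpace μ v Ψ →ₗ[ℂ] ℂ :=
    { toFun := fun h => (starRingEnd ℂ) (f h)
      map_add' := fun a b => by simp
      map_smul' := fun c a => by simp } with hf'
  have hf'' : ∀ h, f' h = (starRingEnd ℂ) (f h) := fun h => rfl
  have hker : J.ker ≤ f'.ker := by
    intro h hh
    rw [LinearMap.mem_ker] at hh ⊢
    have h1 := hC h
    rw [← norm_testSpaceToL1, ← hJ, hh, norm_zero, mul_zero] at h1
    rw [hf'', norm_le_zero_iff.1 h1, map_zero]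
  obtain ⟨e, he⟩ : ∃ e : J.range →ₗ[ℂ] ℂ, ∀ h, e ⟨J h, h, rfl⟩ = f' h := by
    refine ⟨(J.ker.liftQ f' hker) ∘ₗ J.quotKerEquivRange.symm.toLinearMap, fun h => ?_⟩
    have : (⟨J h, h, rfl⟩ : J.range) = J.quotKerEquivRange (J.ker.mkQ h) := rfl
    rw [this]
    simp
  have hbound : ∀ p : J.range, ‖e p‖ ≤ C * ‖p‖ := by
    rintro ⟨_, h, rfl⟩
    rw [he, hf'', RCLike.norm_conj]
    refine (hC h).trans (le_of_eq ?_)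
    rw [← norm_testSpaceToL1]
    rfl
  obtain ⟨g, hg, -⟩ := exists_extension_norm_eq J.range (e.mkContinuous C hbound)
  refine ⟨g, fun h => ?_⟩
  have := hg ⟨J h, h, rfl⟩
  rw [LinearMap.mkContinuous_apply, he] at this
  exact this

end TestSpace

/-! ### Tight frames and the weak resolution of the identity -/

section TightFrame

variable {X : Type*} [MeasurableSpace X] [TopologicalSpace X] [OpensMeasurableSpace X]
variable {E : Type*} [NormedAddCommGroup E] [InnerProductSpace ℂ E]
variable {μ : Measure X} {m : X → X → ℝ} {Ψ Φ : X → E} {A : ℝ}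

theorem IsContinuousTightFrame.memLp (T : IsContinuousTightFrame μ Ψ A) (f : E) :
    MemLp (frameTransform Ψ f) 2 μ := by
  refine ⟨(T.weaklyContinuous f).aestronglyMeasurable, ?_⟩
  rw [eLpNorm_eq_lintegral_rpow_enorm_toReal (by norm_num) (by norm_num)]
  apply ENNReal.rpow_lt_top_of_nonneg (by positivity)
  have h := T.tight f
  simp only [ENNReal.toReal_ofNat, ENNReal.rpow_ofNat]
  rw [h]
  exact ENNReal.ofReal_ne_top

/-- The transform of a tight frame as a linear map into `L²`. -/
def IsContinuousTightFrame.analysis (T : IsContinuousTightFrame μ Ψ A) : E →ₗ[ℂ] Lp ℂ 2 μ where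
  toFun f := (T.memLp f).toLp _
  map_add' f g := by
    rw [← MemLp.toLp_add]
    congr 1
    ext x
    simp [frameTransform]
  map_smul' c f := by
    rw [RingHom.id_apply, ← MemLp.toLp_const_smul]
    congr 1
    ext x
    simp [frameTransform]

theorem IsContinuousTightFrame.norm_analysis_sq (T : IsContinuousTightFrame μ Ψ A) (f : E) :
    ‖T.analysis f‖ ^ 2 = A * ‖f‖ ^ 2 := by
  have h : ENNReal.ofReal (‖T.analysis f‖ ^ 2) = ENNReal.ofReal (A * ‖f‖ ^ 2) := by
    rw [← T.tight f, ENNReal.ofReal_pow (norm_nonneg _), ofReal_norm, Lp.enorm_def,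
      eLpNorm_eq_lintegral_rpow_enorm_toReal (by norm_num) (by norm_num), ← ENNReal.rpow_natCast,
      ← ENNReal.rpow_mul]
    simp only [ENNReal.toReal_ofNat, Nat.cast_ofNat, ENNReal.rpow_ofNat, one_div]
    rw [inv_mul_cancel₀ (by norm_num), ENNReal.rpow_one]
    apply lintegral_congr_ae
    filter_upwards [(T.memLp f).coeFn_toLp] with x hx
    rw [← hx]
    rfl
  have h0 := T.pos
  rwa [ENNReal.ofReal_eq_ofReal_iff (by positivity) (by positivity)] at h

/-- Polarization: the analysis map scales squared norms by `A`, hence inner products too.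
Completeness of `E` plays no role. -/
theorem IsContinuousTightFrame.inner_eq_integral (T : IsContinuousTightFrame μ Ψ A) (f g : E) :
    (inner ℂ f g : ℂ) = (A : ℂ)⁻¹ * ∫ x, inner ℂ f (Ψ x) * inner ℂ (Ψ x) g ∂μ := by
  have hA : (A : ℂ) ≠ 0 := by exact_mod_cast T.pos.ne'
  have e1 : (inner ℂ (T.analysis f) (T.analysis g) : ℂ) = A * inner ℂ f g := by
    have hsq : ∀ h, ((‖T.analysis h‖ : ℝ) : ℂ) ^ 2 = A * ((‖h‖ : ℝ) : ℂ) ^ 2 := fun h => by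
      exact_mod_cast T.norm_analysis_sq h
    rw [inner_eq_sum_norm_sq_div_four, inner_eq_sum_norm_sq_div_four f g, ← map_smul, ← map_add,
      ← map_sub, ← map_sub, ← map_add]
    simp only [Complex.coe_algebraMap] at *
    rw [hsq, hsq, hsq, hsq]
    ring
  have e2 : (inner ℂ (T.analysis f) (T.analysis g) : ℂ) =
      ∫ x, inner ℂ f (Ψ x) * inner ℂ (Ψ x) g ∂μ := by
    rw [L2.inner_def]
    apply integral_congr_ae
    filter_upwards [(T.memLp f).coeFn_toLp, (T.memLp g).coeFn_toLp] with x h1 h2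
    have h1' : T.analysis f x = inner ℂ (Ψ x) f := h1
    have h2' : T.analysis g x = inner ℂ (Ψ x) g := h2
    rw [h1', h2', ← inner_conj_symm f (Ψ x)]
    simp [mul_comm]
  rw [← e2, e1, inv_mul_cancel_left₀ hA]

theorem mem_testSpace_iff {v : X → ℝ} (hv : Measurable v)
    (hΨ : ∀ f, Continuous (frameTransform Ψ f)) (f : E) :
    f ∈ testSpace μ v Ψ ↔ ∫⁻ x, ‖v x‖ₑ * ‖frameTransform Ψ f x‖ₑ ∂μ < ⊤ := by
  have h : f ∈ testSpace μ v Ψ ↔ Integrable (fun x => (v x : ℂ) * frameTransform Ψ f x) μ := Iff.rfl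
  have hm : AEStronglyMeasurable (fun x => (v x : ℂ) * frameTransform Ψ f x) μ :=
    ((Complex.measurable_ofReal.comp hv).mul (hΨ f).measurable).aestronglyMeasurable
  rw [h, Integrable, and_iff_right hm, HasFiniteIntegral]
  simp [enorm_mul, enorm_complex_ofReal]

theorem HasFiniteRows.mem_testSpace (hm : IsKernelWeight m)
    (hΦ : ∀ f, Continuous (frameTransform Φ f)) (h : HasFiniteRows μ m Ψ Φ) (z x : X) :
    Ψ x ∈ testSpace μ (fun y => m y z) Φ := by
  obtain ⟨B, hB, hrow⟩ := h
  rw [mem_testSpace_iff (hm.measurable z) hΦ]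
  exact (HasFiniteRows.lintegral_testWeight_le hm (hrow x) z).trans_lt
    (ENNReal.mul_lt_top hB.lt_top (by simp))

end TightFrame

/-! ### Passing between test spaces of two systems -/

section Transfer

variable {X : Type*} [MeasurableSpace X] [TopologicalSpace X] [OpensMeasurableSpace X]
  [TopologicalSpace.MetrizableSpace X] [SecondCountableTopology X]
variable {E : Type*} [NormedAddCommGroup E] [InnerProductSpace ℂ E]
variable {μ : Measure X} {m : X → X → ℝ} {Ψ Φ : X → E} {A : ℝ}

/-- Weak continuity makes the kernel only separately continuous. Joint measurability is the
Carathéodory criterion, which is where metrizability and second countability of `X` enter. -/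
theorem measurable_inner_of_weaklyContinuous (hΨ : ∀ f, Continuous (frameTransform Ψ f))
    (hΦ : ∀ f, Continuous (frameTransform Φ f)) :
    Measurable (Function.uncurry fun x y => (inner ℂ (Ψ x) (Φ y) : ℂ)) := by
  refine measurable_uncurry_of_continuous_of_measurable (fun y => hΨ (Φ y)) fun x => ?_
  have h : (fun y => (inner ℂ (Ψ x) (Φ y) : ℂ)) =
      fun y => (starRingEnd ℂ) (frameTransform Φ (Ψ x) y) := by
    ext y
    exact (inner_conj_symm _ _).symm
  rw [h]
  exact (Complex.continuous_conj.comp (hΦ (Ψ x))).measurable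

/-- The columns of one mixed kernel are, in modulus, the rows of the other, and `m` is symmetric;
row bounds in both orders therefore control both parts of the `𝒜_m` norm. -/
theorem HasFiniteRows.memKernelAlgebra (hm : IsKernelWeight m)
    (hΨ : ∀ f, Continuous (frameTransform Ψ f)) (hΦ : ∀ f, Continuous (frameTransform Φ f))
    (h : HasFiniteRows μ m Ψ Φ) (h' : HasFiniteRows μ m Φ Ψ) (c : ℂ) :
    MemKernelAlgebra μ m fun x y => c * inner ℂ (Ψ x) (Φ y) := by
  refine ⟨((measurable_inner_of_weaklyContinuous hΨ hΦ).const_mul c).aestronglyMeasurable, ?_⟩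
  obtain ⟨B, hB, hrow⟩ := h
  obtain ⟨B', hB', hrow'⟩ := h'
  have e : ∀ x y, ‖c * inner ℂ (Ψ x) (Φ y) * (m x y : ℂ)‖ₑ =
      ‖c‖ₑ * (‖(inner ℂ (Ψ x) (Φ y) : ℂ)‖ₑ * ENNReal.ofReal (m x y)) := fun x y => by
    rw [enorm_mul, enorm_mul, enorm_complex_ofReal, Real.enorm_of_nonneg (hm.pos _ _).le, mul_assoc]
  refine max_lt ?_ ?_
  · refine lt_of_le_of_lt (essSup_le_of_ae_le (‖c‖ₑ * B) (Eventually.of_forall fun x => ?_))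
      (ENNReal.mul_lt_top (by simp) hB.lt_top)
    simp only [e]
    rw [lintegral_const_mul' _ _ (by simp)]
    gcongr
    exact hrow x
  · refine lt_of_le_of_lt (essSup_le_of_ae_le (‖c‖ₑ * B') (Eventually.of_forall fun y => ?_))
      (ENNReal.mul_lt_top (by simp) hB'.lt_top)
    simp only [e]
    rw [lintegral_const_mul' _ _ (by simp)]
    gcongr
    refine le_trans (le_of_eq ?_) (hrow' y)
    apply lintegral_congr
    intro x
    rw [hm.symm x y, enorm_inner_symm]

/-- A Schur-type estimate: insert the resolution of the identity given by `Ψ` into `V_Φ f`,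
interchange the integrals by Tonelli, and apply the weighted row bound. -/
theorem lintegral_frameTransform_le [SFinite μ] (hm : IsKernelWeight m)
    (T : IsContinuousTightFrame μ Ψ A) (hΦ : ∀ f, Continuous (frameTransform Φ f)) {B : ℝ≥0∞}
    (hrow : ∀ x, ∫⁻ y, ‖(inner ℂ (Ψ x) (Φ y) : ℂ)‖ₑ * ENNReal.ofReal (m x y) ∂μ ≤ B)
    (f : E) (z : X) :
    ∫⁻ y, ‖m y z‖ₑ * ‖frameTransform Φ f y‖ₑ ∂μ ≤
      ‖A⁻¹‖ₑ * B * ∫⁻ x, ‖m x z‖ₑ * ‖frameTransform Ψ f x‖ₑ ∂μ := by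
  have hmeas : Measurable (Function.uncurry fun y x =>
      ‖m y z‖ₑ * (‖(inner ℂ (Φ y) (Ψ x) : ℂ)‖ₑ * ‖frameTransform Ψ f x‖ₑ)) := by
    have h1 : Measurable fun p : X × X => ‖m p.1 z‖ₑ :=
      ((hm.measurable z).comp measurable_fst).enorm
    have h2 : Measurable fun p : X × X => ‖(inner ℂ (Φ p.1) (Ψ p.2) : ℂ)‖ₑ :=
      (measurable_inner_of_weaklyContinuous hΦ T.weaklyContinuous).enorm
    have h3 : Measurable fun p : X × X => ‖frameTransform Ψ f p.2‖ₑ :=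
      ((T.weaklyContinuous f).measurable.comp measurable_snd).enorm
    exact h1.mul (h2.mul h3)
  calc ∫⁻ y, ‖m y z‖ₑ * ‖frameTransform Φ f y‖ₑ ∂μ
      ≤ ∫⁻ y, ‖A⁻¹‖ₑ * ∫⁻ x, ‖m y z‖ₑ *
          (‖(inner ℂ (Φ y) (Ψ x) : ℂ)‖ₑ * ‖frameTransform Ψ f x‖ₑ) ∂μ ∂μ := by
        apply lintegral_mono
        intro y
        beta_reduce
        rw [lintegral_const_mul' _ _ (by simp), mul_left_comm, frameTransform,
          T.inner_eq_integral (Φ y) f, enorm_mul, ← Complex.ofReal_inv, enorm_complex_ofReal]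
        gcongr
        refine (enorm_integral_le_lintegral_enorm _).trans (le_of_eq ?_)
        simp [enorm_mul, frameTransform]
    _ = ‖A⁻¹‖ₑ * ∫⁻ x, ∫⁻ y, ‖m y z‖ₑ *
          (‖(inner ℂ (Φ y) (Ψ x) : ℂ)‖ₑ * ‖frameTransform Ψ f x‖ₑ) ∂μ ∂μ := by
        rw [lintegral_const_mul' _ _ (by simp), lintegral_lintegral_swap hmeas.aemeasurable]
    _ ≤ ‖A⁻¹‖ₑ * ∫⁻ x, B * (‖m x z‖ₑ * ‖frameTransform Ψ f x‖ₑ) ∂μ := by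
        gcongr with x
        simp only [← mul_assoc]
        rw [lintegral_mul_const' _ _ (by simp)]
        gcongr
        exact HasFiniteRows.lintegral_testWeight_le hm (hrow x) z
    _ = _ := by
        have h1 : Measurable fun x => ‖m x z‖ₑ * ‖frameTransform Ψ f x‖ₑ :=
          (hm.measurable z).enorm.mul (T.weaklyContinuous f).measurable.enorm
        rw [lintegral_const_mul _ h1, mul_assoc]

theorem testSpace_le_and_testNorm_le [SFinite μ] (hm : IsKernelWeight m)
    (T : IsContinuousTightFrame μ Ψ A) (hΦ : ∀ f, Continuous (frameTransform Φ f))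
    (h : HasFiniteRows μ m Ψ Φ) (z : X) :
    testSpace μ (fun x => m x z) Ψ ≤ testSpace μ (fun x => m x z) Φ ∧
    ∃ C : ℝ, 0 ≤ C ∧ ∀ f ∈ testSpace μ (fun x => m x z) Ψ,
      testNorm μ (fun x => m x z) Φ f ≤ C * testNorm μ (fun x => m x z) Ψ f := by
  obtain ⟨B, hB, hrow⟩ := h
  have key := lintegral_frameTransform_le hm T hΦ hrow
  have hC : ‖A⁻¹‖ₑ * B ≠ ⊤ := ENNReal.mul_ne_top (by simp) hB
  have hle : testSpace μ (fun x => m x z) Ψ ≤ testSpace μ (fun x => m x z) Φ := by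
    intro f hf
    rw [mem_testSpace_iff (hm.measurable z) T.weaklyContinuous] at hf
    rw [mem_testSpace_iff (hm.measurable z) hΦ]
    exact (key f z).trans_lt (ENNReal.mul_lt_top hC.lt_top hf)
  refine ⟨hle, (‖A⁻¹‖ₑ * B).toReal, ENNReal.toReal_nonneg, fun f hf => ?_⟩
  have k := key f z
  rw [← ofReal_testNorm (v := fun x => m x z) hf, ← ofReal_testNorm (v := fun x => m x z) (hle hf),
    ← ENNReal.ofReal_toReal hC, ← ENNReal.ofReal_mul ENNReal.toReal_nonneg] at k
  exact (ENNReal.ofReal_le_ofReal_iff (mul_nonneg ENNReal.toReal_nonneg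
    (testNorm_nonneg _ _))).1 k

end Transfer

/-- Injectivity of the embedding of `Y` makes the norm independent of the chosen representative. -/
theorem SolidSpace.fnNorm_eq {X : Type*} [MeasurableSpace X] [TopologicalSpace X]
    {μ : Measure X} {Y : Type*} [NormedAddCommGroup Y] [NormedSpace ℂ Y]
    (𝒴 : SolidSpace μ Y) {G : X → ℂ} {y : Y} (h : 𝒴.toFun y =ᵐ[μ] G) : 𝒴.fnNorm G = ‖y‖ := by
  have hG : 𝒴.Mem G := ⟨y, h⟩
  rw [SolidSpace.fnNorm, dif_pos hG]
  congr 1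
  apply 𝒴.injective
  exact AEEqFun.ext (hG.choose_spec.trans h.symm)

/-! ### The reproducing formula on the anti-dual -/

section Reproducing

variable {X : Type*} [MeasurableSpace X] [TopologicalSpace X] [OpensMeasurableSpace X]
  [TopologicalSpace.MetrizableSpace X] [SecondCountableTopology X]
variable {E : Type*} [NormedAddCommGroup E] [InnerProductSpace ℂ E]
variable {μ : Measure X} [SFinite μ] {m : X → X → ℝ} {Ψ Φ : X → E} {A A' : ℝ}

theorem integrable_prod_reproducing (hm : IsKernelWeight m)
    (hΨ : ∀ f, Continuous (frameTransform Ψ f)) (h : HasFiniteRows μ m Ψ Ψ) {z : X} {g : E}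
    (hg : g ∈ testSpace μ (fun x => m x z) Ψ) :
    Integrable (fun p : X × X => frameTransform Ψ g p.1 *
      ((m p.2 z : ℂ) * frameTransform Ψ (Ψ p.1) p.2)) (μ.prod μ) := by
  obtain ⟨B, hB, hrow⟩ := h
  have hk : Measurable fun p : X × X => (m p.2 z : ℂ) * frameTransform Ψ (Ψ p.1) p.2 :=
    (Complex.measurable_ofReal.comp ((hm.measurable z).comp measurable_snd)).mul
      ((measurable_inner_of_weaklyContinuous hΨ hΨ).comp measurable_swap)
  have hc : Measurable fun p : X × X => frameTransform Ψ g p.1 :=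
    (hΨ g).measurable.comp measurable_fst
  refine ⟨(hc.mul hk).aestronglyMeasurable, ?_⟩
  rw [HasFiniteIntegral, lintegral_prod _ (by exact (hc.mul hk).enorm.aemeasurable)]
  rw [mem_testSpace_iff (hm.measurable z) hΨ] at hg
  calc ∫⁻ x, ∫⁻ y, ‖frameTransform Ψ g x * ((m y z : ℂ) * frameTransform Ψ (Ψ x) y)‖ₑ ∂μ ∂μ
      ≤ ∫⁻ x, B * (‖m x z‖ₑ * ‖frameTransform Ψ g x‖ₑ) ∂μ := by
        apply lintegral_mono
        intro x
        simp only [enorm_mul, enorm_complex_ofReal]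
        rw [lintegral_const_mul' _ _ (by simp), ← mul_assoc,
          mul_comm (B * _) ‖frameTransform Ψ g x‖ₑ]
        gcongr
        exact HasFiniteRows.lintegral_testWeight_le hm (hrow x) z
    _ < ⊤ := by
        rw [lintegral_const_mul' _ _ hB]
        exact ENNReal.mul_lt_top hB.lt_top hg

/-- The identity `g = A⁻¹ ∫ V_Ψ g(x) ψ_x dμ(x)` becomes a Bochner integral after the test space is
embedded in `L¹`. As the test space is not known to be complete, the integral is taken in `L¹`, and
the functional is first extended to `L¹` so that it can be interchanged with the integral. -/
theorem MemAntidual.apply_eq_integral [IsSeparable μ] (hm : IsKernelWeight m)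
    (T : IsContinuousTightFrame μ Ψ A) (h : HasFiniteRows μ m Ψ Ψ) {z : X}
    {f : AntiFunctional μ (fun x => m x z) Ψ} (hf : MemAntidual μ (fun x => m x z) Ψ f)
    (g : testSpace μ (fun x => m x z) Ψ) :
    f g = ∫ x, (A : ℂ)⁻¹ * inner ℂ (g : E) (Ψ x) *
      extTransform μ (fun x => m x z) Ψ f x ∂μ := by
  have hΨ := T.weaklyContinuous
  have hmem : ∀ x, Ψ x ∈ testSpace μ (fun x => m x z) Ψ := fun x => h.mem_testSpace hm hΨ z x
  obtain ⟨L, hL⟩ := hf.exists_extension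
  have hk : Measurable (Function.uncurry fun x y => (m y z : ℂ) * frameTransform Ψ (Ψ x) y) :=
    (Complex.measurable_ofReal.comp ((hm.measurable z).comp measurable_snd)).mul
      ((measurable_inner_of_weaklyContinuous hΨ hΨ).comp measurable_swap)
  obtain ⟨hint, hae⟩ := integral_smul_toL1_ae_eq hk
    (fun x => integrable_of_mem_testSpace (hmem x)) (hΨ g).measurable
    (integrable_prod_reproducing hm hΨ h g.2)
  set J := testSpaceToL1 μ (fun x => m x z) Ψ with hJ
  have hint' : Integrable (fun x => frameTransform Ψ (g : E) x • J ⟨Ψ x, hmem x⟩) μ := hint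
  have hJg : J g = (A : ℂ)⁻¹ • ∫ x, frameTransform Ψ g x • J ⟨Ψ x, hmem x⟩ ∂μ := by
    apply Lp.ext
    refine EventuallyEq.trans (Integrable.coeFn_toL1 (integrable_of_mem_testSpace g.2)) ?_
    filter_upwards [hae, Lp.coeFn_smul (A : ℂ)⁻¹ (∫ x, frameTransform Ψ g x • J ⟨Ψ x, hmem x⟩ ∂μ)]
      with y h1 h2
    rw [h2, Pi.smul_apply]
    refine Eq.trans ?_ (congrArg (fun t => (A : ℂ)⁻¹ • t) h1.symm)
    have e := T.inner_eq_integral (Ψ y) (g : E)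
    simp only [frameTransform, smul_eq_mul] at e ⊢
    rw [e, mul_left_comm, ← integral_const_mul]
    congr 2
    ext x
    ring
  have e1 : (starRingEnd ℂ) (f g) =
      (A : ℂ)⁻¹ * ∫ x, frameTransform Ψ g x * (starRingEnd ℂ) (f ⟨Ψ x, hmem x⟩) ∂μ := by
    rw [← hL, hJg, map_smul, ← L.integral_comp_comm hint', smul_eq_mul]
    congr 2
    ext x
    rw [map_smul, hL, smul_eq_mul]
  have e2 := congrArg (starRingEnd ℂ) e1
  rw [Complex.conj_conj, map_mul, ← integral_conj, ← integral_const_mul] at e2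
  rw [e2]
  congr 1
  ext x
  simp [frameTransform, extTransform, hmem x, mul_assoc]

/-- The reproducing formula at `g = φ_y`: the extended transforms are related by the same Gramian
kernel as on the Hilbert space. The inclusion only re-types the functional. -/
theorem MemAntidual.extTransform_comp_inclusion [IsSeparable μ] (hm : IsKernelWeight m)
    (T : IsContinuousTightFrame μ Ψ A) (h : HasFiniteRows μ m Ψ Ψ) {z : X}
    (hle : testSpace μ (fun x => m x z) Φ ≤ testSpace μ (fun x => m x z) Ψ)
    (hΦ : ∀ y, Φ y ∈ testSpace μ (fun x => m x z) Φ)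
    {f : AntiFunctional μ (fun x => m x z) Ψ} (hf : MemAntidual μ (fun x => m x z) Ψ f) (y : X) :
    extTransform μ (fun x => m x z) Φ (f.comp (Submodule.inclusion hle)) y =
      ∫ x, (A : ℂ)⁻¹ * inner ℂ (Φ y) (Ψ x) * extTransform μ (fun x => m x z) Ψ f x ∂μ := by
  rw [extTransform, dif_pos (hΦ y)]
  exact hf.apply_eq_integral hm T h ⟨Φ y, hle (hΦ y)⟩

theorem coorbit_comp_inclusion [IsSeparable μ] (hm : IsKernelWeight m)
    (T : IsContinuousTightFrame μ Ψ A) (hΦ : ∀ f, Continuous (frameTransform Φ f))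
    (hΨΨ : HasFiniteRows μ m Ψ Ψ) (hΨΦ : HasFiniteRows μ m Ψ Φ) (hΦΨ : HasFiniteRows μ m Φ Ψ)
    (hΦΦ : HasFiniteRows μ m Φ Φ) (z : X)
    (hle : testSpace μ (fun x => m x z) Φ ≤ testSpace μ (fun x => m x z) Ψ)
    {C : ℝ} (hCn : ∀ f ∈ testSpace μ (fun x => m x z) Φ,
      testNorm μ (fun x => m x z) Ψ f ≤ C * testNorm μ (fun x => m x z) Φ f)
    {Y : Type*} [NormedAddCommGroup Y] [NormedSpace ℂ Y] (𝒴 : SolidSpace μ Y)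
    (h𝒴 : 𝒴.IsKernelModule m) {f : AntiFunctional μ (fun x => m x z) Ψ}
    (hf : f ∈ coorbit (fun x => m x z) Ψ 𝒴) :
    f.comp (Submodule.inclusion hle) ∈ coorbit (fun x => m x z) Φ 𝒴 ∧
    coorbitNorm (fun x => m x z) Φ 𝒴 (f.comp (Submodule.inclusion hle)) ≤
      (kernelNorm μ m fun x y => (A : ℂ)⁻¹ * inner ℂ (Φ x) (Ψ y)).toReal *
        coorbitNorm (fun x => m x z) Ψ 𝒴 f := by
  obtain ⟨hfd, y, hy⟩ := hf
  obtain ⟨-, G', hG', hn⟩ := h𝒴 _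
    (hΦΨ.memKernelAlgebra hm hΦ T.weaklyContinuous hΨΦ (A : ℂ)⁻¹) y
  have hG : 𝒴.toFun G' =ᵐ[μ]
      extTransform μ (fun x => m x z) Φ (f.comp (Submodule.inclusion hle)) := by
    refine hG'.trans (Eventually.of_forall fun x => ?_)
    rw [hfd.extTransform_comp_inclusion hm T hΨΨ hle fun y => hΦΦ.mem_testSpace hm hΦ z y]
    apply integral_congr_ae
    filter_upwards [hy] with t ht
    rw [ht]
  refine ⟨⟨?_, G', hG⟩, ?_⟩
  · obtain ⟨C', hC'⟩ := hfd
    -- `MemAntidual` prescribes no sign for its constant, hence the absolute value before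
    -- multiplying the norm inequality by it.
    refine ⟨|C'| * C, fun h => ?_⟩
    calc ‖f (Submodule.inclusion hle h)‖ ≤ C' * testNorm μ (fun x => m x z) Ψ h := hC' _
      _ ≤ |C'| * testNorm μ (fun x => m x z) Ψ h := by
          gcongr
          · exact testNorm_nonneg _ _
          · exact le_abs_self _
      _ ≤ |C'| * (C * testNorm μ (fun x => m x z) Φ h) := by
          gcongr
          exact hCn _ h.2
      _ = _ := by ring
  · rw [coorbitNorm, coorbitNorm, 𝒴.fnNorm_eq hG, 𝒴.fnNorm_eq hy]
    exact hn

/-- Two tight frames whose mixed kernels lie in the kernel algebra generate the same coorbit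
spaces. -/
theorem generateSameCoorbits_of_hasFiniteRows [IsSeparable μ] (hm : IsKernelWeight m)
    (T : IsContinuousTightFrame μ Ψ A) (T' : IsContinuousTightFrame μ Φ A')
    (hΨΨ : HasFiniteRows μ m Ψ Ψ) (hΨΦ : HasFiniteRows μ m Ψ Φ) (hΦΨ : HasFiniteRows μ m Φ Ψ)
    (hΦΦ : HasFiniteRows μ m Φ Φ) : GenerateSameCoorbits μ m Ψ Φ := by
  intro z
  obtain ⟨hle, C, hC, hCn⟩ := testSpace_le_and_testNorm_le hm T T'.weaklyContinuous hΨΦ z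
  obtain ⟨hle', C', hC', hCn'⟩ := testSpace_le_and_testNorm_le hm T' T.weaklyContinuous hΦΨ z
  have heq := le_antisymm hle' hle
  refine ⟨heq, ⟨max C C', fun f hf => ⟨?_, ?_⟩⟩, ?_⟩
  · refine (hCn f hf).trans ?_
    gcongr
    · exact testNorm_nonneg _ _
    · exact le_max_left _ _
  · refine (hCn' f (hle hf)).trans ?_
    gcongr
    · exact testNorm_nonneg _ _
    · exact le_max_right _ _
  intro Y _ _ _ _ 𝒴 h𝒴
  have fwd := fun f hf => coorbit_comp_inclusion hm T T'.weaklyContinuous hΨΨ hΨΦ hΦΨ hΦΦ z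
    hle' hCn' 𝒴 h𝒴 (f := f) hf
  have bwd := fun f hf => coorbit_comp_inclusion hm T' T.weaklyContinuous hΦΦ hΦΨ hΨΦ hΨΨ z
    hle hCn 𝒴 h𝒴 (f := f) hf
  have hcomp : ∀ f : AntiFunctional μ (fun x => m x z) Ψ,
      (f.comp (Submodule.inclusion hle')).comp (Submodule.inclusion hle) = f := fun f => rfl
  refine ⟨fun f => ⟨fun hf => (fwd f hf).1, fun hf => ?_⟩,
    max (kernelNorm μ m fun x y => (A : ℂ)⁻¹ * inner ℂ (Φ x) (Ψ y)).toReal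
      (kernelNorm μ m fun x y => (A' : ℂ)⁻¹ * inner ℂ (Ψ x) (Φ y)).toReal,
    fun f hf => ⟨?_, ?_⟩⟩
  · have := (bwd _ hf).1
    rwa [hcomp] at this
  · refine (fwd f hf).2.trans ?_
    gcongr
    · obtain ⟨y, hy⟩ := hf.2
      rw [coorbitNorm, 𝒴.fnNorm_eq hy]
      exact norm_nonneg _
    · exact le_max_left _ _
  · have hf' := (fwd f hf).1
    have := (bwd _ hf').2
    rw [hcomp] at this
    refine this.trans ?_
    gcongr
    · obtain ⟨y, hy⟩ := hf'.2
      rw [coorbitNorm, 𝒴.fnNorm_eq hy]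
      exact norm_nonneg _
    · exact le_max_right _ _

end Reproducing

/-! ### Warping functions and the change of variables `t = F⁻¹(s)` -/

section Warping

variable {D : Set ℝ} {F : ℝ → ℝ}

theorem IsWarpingFunction.isOpen (hF : IsWarpingFunction D F) : IsOpen D := by
  rcases hF.domain with h | h
  · rw [h]; exact isOpen_univ
  · rw [h]; exact isOpen_Ioi

theorem IsWarpingFunction.warpInv_mem (hF : IsWarpingFunction D F) (s : ℝ) : warpInv D F s ∈ D :=
  Function.invFunOn_mem (hF.bijOn.surjOn (mem_univ s))

theorem IsWarpingFunction.apply_warpInv (hF : IsWarpingFunction D F) (s : ℝ) :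
    F (warpInv D F s) = s :=
  Function.invFunOn_eq (hF.bijOn.surjOn (mem_univ s))

theorem IsWarpingFunction.warpInv_apply (hF : IsWarpingFunction D F) {t : ℝ} (ht : t ∈ D) :
    warpInv D F (F t) = t :=
  hF.bijOn.injOn (hF.warpInv_mem _) ht (hF.apply_warpInv _)

theorem IsWarpingFunction.injective_warpInv (hF : IsWarpingFunction D F) :
    Function.Injective (warpInv D F) :=
  Function.LeftInverse.injective hF.apply_warpInv

theorem IsWarpingFunction.image_warpInv (hF : IsWarpingFunction D F) :
    warpInv D F '' univ = D := by
  apply Subset.antisymm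
  · rintro _ ⟨s, -, rfl⟩
    exact hF.warpInv_mem s
  · exact fun t ht => ⟨F t, mem_univ _, hF.warpInv_apply ht⟩

theorem IsWarpingFunction.warpWeight_pos (hF : IsWarpingFunction D F) (s : ℝ) :
    0 < warpWeight D F s := by
  obtain ⟨v, -, hw, -⟩ := hF.moderate
  exact hw.2 s

/-- No inverse function theorem is needed: moderateness includes `w > 0`, while `deriv` takes the
default value `0` wherever differentiability fails. -/
theorem IsWarpingFunction.hasDerivAt_warpInv (hF : IsWarpingFunction D F) (s : ℝ) :
    HasDerivAt (warpInv D F) (warpWeight D F s) s :=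
  (differentiableAt_of_deriv_ne_zero (hF.warpWeight_pos s).ne').hasDerivAt

theorem IsWarpingFunction.continuous_warpInv (hF : IsWarpingFunction D F) :
    Continuous (warpInv D F) :=
  continuous_iff_continuousAt.2 fun s => (hF.hasDerivAt_warpInv s).continuousAt

theorem IsWarpingFunction.deriv_warpInv (hF : IsWarpingFunction D F) (s : ℝ) :
    deriv F (warpInv D F s) = (warpWeight D F s)⁻¹ := by
  have h1 : HasDerivAt F (deriv F (warpInv D F s)) (warpInv D F s) :=
    (differentiableAt_of_deriv_ne_zero (hF.deriv_pos _ (hF.warpInv_mem s)).ne').hasDerivAt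
  have h2 := h1.comp s (hF.hasDerivAt_warpInv s)
  have h3 : F ∘ warpInv D F = id := funext hF.apply_warpInv
  rw [h3] at h2
  exact eq_inv_of_mul_eq_one_left (h2.unique (hasDerivAt_id s))

theorem IsWarpingFunction.deriv_eq (hF : IsWarpingFunction D F) {x : ℝ} (hx : x ∈ D) :
    deriv F x = (warpWeight D F (F x))⁻¹ := by
  rw [← hF.deriv_warpInv, hF.warpInv_apply hx]

theorem IsWarpingFunction.continuous_restrict (hF : IsWarpingFunction D F) :
    Continuous fun x : D => F x :=
  continuousOn_iff_continuous_domRestrict.1 hF.contDiffOn.continuousOn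

theorem IsWarpingFunction.measurable_indicator (hF : IsWarpingFunction D F) :
    Measurable (D.indicator F) := by
  classical
  rw [← piecewise_eq_indicator]
  exact hF.contDiffOn.continuousOn.measurable_piecewise continuousOn_const
    hF.isOpen.measurableSet

theorem IsWarpingFunction.lintegral_eq (hF : IsWarpingFunction D F) (g : ℝ → ℝ≥0∞) :
    ∫⁻ t in D, g t = ∫⁻ s, ENNReal.ofReal (warpWeight D F s) * g (warpInv D F s) := by
  have h := lintegral_image_eq_lintegral_abs_deriv_mul MeasurableSet.univ
    (fun s _ => (hF.hasDerivAt_warpInv s).hasDerivWithinAt) hF.injective_warpInv.injOn g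
  rw [hF.image_warpInv, Measure.restrict_univ] at h
  rw [h]
  simp only [abs_of_pos (hF.warpWeight_pos _)]

theorem IsWarpingFunction.integral_eq (hF : IsWarpingFunction D F) (g : ℝ → ℂ) :
    ∫ t in D, g t = ∫ s, (warpWeight D F s : ℂ) * g (warpInv D F s) := by
  have h := integral_image_eq_integral_abs_deriv_smul MeasurableSet.univ
    (fun s _ => (hF.hasDerivAt_warpInv s).hasDerivWithinAt) hF.injective_warpInv.injOn g
  rw [hF.image_warpInv, Measure.restrict_univ] at h
  rw [h]
  simp only [abs_of_pos (hF.warpWeight_pos _), Complex.real_smul]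

theorem IsWarpingFunction.lintegral_subtype_eq (hF : IsWarpingFunction D F) (g : D → ℝ≥0∞) :
    ∫⁻ x, g x ∂((volume : Measure ℝ).comap ((↑) : D → ℝ)) =
      ∫⁻ s, ENNReal.ofReal (warpWeight D F s) * g ⟨warpInv D F s, hF.warpInv_mem s⟩ := by
  set g' : ℝ → ℝ≥0∞ := Function.extend Subtype.val g 0
  have hg : ∀ x : D, g x = g' x := fun x => (Subtype.val_injective.extend_apply g 0 x).symm
  simp only [hg]
  rw [lintegral_subtype_comap hF.isOpen.measurableSet, hF.lintegral_eq]

theorem IsWarpingFunction.sigmaFinite_comap (hF : IsWarpingFunction D F) :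
    SigmaFinite ((volume : Measure ℝ).comap ((↑) : D → ℝ)) := by
  have h1 : LocallyCompactSpace D := hF.isOpen.locallyCompactSpace
  have h2 : IsFiniteMeasureOnCompacts ((volume : Measure ℝ).comap ((↑) : D → ℝ)) :=
    .comap' _ continuous_subtype_val (MeasurableEmbedding.subtype_coe hF.isOpen.measurableSet)
  infer_instance

theorem IsWarpingFunction.sigmaFinite_phaseMeasure (hF : IsWarpingFunction D F) :
    SigmaFinite (phaseMeasure D) := by
  have := hF.sigmaFinite_comap
  unfold phaseMeasure
  infer_instance

theorem IsWarpingFunction.lintegral_phaseMeasure (hF : IsWarpingFunction D F)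
    {g : PhaseSpace D → ℝ≥0∞} (hg : Measurable g) :
    ∫⁻ q, g q ∂(phaseMeasure D) = ∫⁻ s, ENNReal.ofReal (warpWeight D F s) *
      ∫⁻ ω, g (⟨warpInv D F s, hF.warpInv_mem s⟩, ω) := by
  have := hF.sigmaFinite_comap
  rw [phaseMeasure, lintegral_prod _ hg.aemeasurable, hF.lintegral_subtype_eq]

/-- The constants and weights that enter the kernel estimates. -/
structure WarpBounds (D : Set ℝ) (F v : ℝ → ℝ) (C D₁ : ℝ) : Prop where
  warp : IsWarpingFunction D F
  contDiff : ContDiff ℝ 1 (warpWeight D F)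
  const_pos : 0 < C
  weight_add : ∀ x y, warpWeight D F (x + y) ≤ C * (warpWeight D F x * warpWeight D F y)
  const_nonneg : 0 ≤ D₁
  deriv_le : ∀ x, |deriv (warpWeight D F) x| ≤ D₁ * warpWeight D F x
  measurable : Measurable v
  symm : ∀ x, v (-x) = v x
  submul : ∀ x y, v (x + y) ≤ v x * v y
  one_le : ∀ x, 1 ≤ v x

/-- From `v(0) ≤ v(0)²` follows `1 ≤ v(0)`, and symmetry gives `v(0) ≤ v(x)²`. -/
theorem one_le_of_symm_of_submul {v : ℝ → ℝ} (hpos : ∀ x, 0 < v x) (hsymm : ∀ x, v (-x) = v x)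
    (hsub : ∀ x y, v (x + y) ≤ v x * v y) (x : ℝ) : 1 ≤ v x := by
  have h0 : 1 ≤ v 0 := by
    have h := hsub 0 0
    rw [add_zero] at h
    have := hpos 0
    nlinarith
  have h1 := hsub x (-x)
  rw [add_neg_cancel, hsymm] at h1
  have := hpos x
  nlinarith

/-- Here `v` is the symmetric weight that will moderate `m₁ ∘ F⁻¹`; the growth of `w` itself is
governed by the constant `C`. -/
theorem IsWarpingFunction.exists_warpBounds (hF : IsWarpingFunction D F)
    (hw : ContDiff ℝ 1 (warpWeight D F))
    (hsub : ∃ C : ℝ, ∀ x y, warpWeight D F (x + y) / (warpWeight D F x * warpWeight D F y) ≤ C)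
    (hder : ∃ D₁ : ℝ, ∀ x, |deriv (warpWeight D F) x / warpWeight D F x| ≤ D₁)
    {v : ℝ → ℝ} (hsymm : ∀ x, v (-x) = v x) (hv : IsSubmultiplicative v) :
    ∃ C D₁ : ℝ, WarpBounds D F v C D₁ := by
  obtain ⟨C, hC⟩ := hsub
  obtain ⟨D₁, hD₁⟩ := hder
  have hpos := hF.warpWeight_pos
  refine ⟨C, D₁, hF, hw, ?_, fun x y => ?_, ?_, fun x => ?_, hv.1.1, hsymm, hv.2,
    one_le_of_symm_of_submul hv.1.2 hsymm hv.2⟩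
  · exact (div_pos (hpos _) (mul_pos (hpos _) (hpos _))).trans_le (hC 0 0)
  · exact (div_le_iff₀ (mul_pos (hpos _) (hpos _))).1 (hC x y)
  · exact (abs_nonneg _).trans (hD₁ 0)
  · have h := hD₁ x
    rwa [abs_div, abs_of_pos (hpos x), div_le_iff₀ (hpos x)] at h

end Warping

/-! ### Local boundedness of weights and weighted integrability of windows -/

/-- A function that is bounded on bounded sets. -/
def LocallyBounded (f : ℝ → ℝ) : Prop := ∀ R : ℝ, ∃ B : ℝ, ∀ x, |x| ≤ R → |f x| ≤ B

theorem locallyBounded_of_continuous {f : ℝ → ℝ} (hf : Continuous f) : LocallyBounded f := by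
  intro R
  obtain ⟨B, hB⟩ := (isCompact_Icc (a := -R) (b := R)).exists_bound_of_continuousOn hf.continuousOn
  exact ⟨B, fun x hx => hB x (abs_le.1 hx)⟩

/-- Measurable symmetric submultiplicative functions are locally bounded, by Steinhaus' theorem. -/
theorem locallyBounded_of_submul {v : ℝ → ℝ} (hm : Measurable v) (hone : ∀ x, 1 ≤ v x)
    (hsymm : ∀ x, v (-x) = v x) (hsub : ∀ x y, v (x + y) ≤ v x * v y) : LocallyBounded v := by
  have hpos : ∀ x, 0 < v x := fun x => one_pos.trans_le (hone x)
  -- The sublevel sets exhaust the line, so one of them has positive measure. Its difference set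
  -- contains a ball around `0`, and on differences `v` is at most `n²` by symmetry.
  have hU : (⋃ n : ℕ, {x | v x ≤ n}) = univ := by
    ext x
    simpa using exists_nat_ge (v x)
  obtain ⟨n, hn⟩ : ∃ n : ℕ, 0 < volume {x | v x ≤ n} := by
    apply exists_measure_pos_of_not_measure_iUnion_null
    rw [hU]
    simp
  have hE := Measure.sub_mem_nhds_zero_of_addHaar_pos volume {x | v x ≤ n}
    (measurableSet_le hm measurable_const) hn
  obtain ⟨δ, hδ, hball⟩ := Metric.mem_nhds_iff.1 hE
  have hloc : ∀ x, |x| < δ → v x ≤ (n : ℝ) * n := by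
    intro x hx
    obtain ⟨a, ha, b, hb, rfl⟩ := hball (mem_ball_zero_iff.2 hx)
    calc v (a - b) ≤ v a * v (-b) := by rw [sub_eq_add_neg]; exact hsub _ _
      _ ≤ n * n := by
        rw [hsymm]
        exact mul_le_mul ha hb (hpos b).le (Nat.cast_nonneg n)
  have hiter : ∀ y, ∀ k : ℕ, v ((k + 1 : ℕ) * y) ≤ v y ^ (k + 1) := by
    intro y k
    induction k with
    | zero => simp
    | succ k ih =>
      have e : ((k + 1 + 1 : ℕ) : ℝ) * y = ((k + 1 : ℕ) : ℝ) * y + y := by push_cast; ring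
      rw [e, pow_succ]
      exact (hsub _ _).trans (by gcongr; exact (hpos y).le)
  intro R
  -- A point of modulus at most `R` is reached in `k + 1` equal steps of length below `δ`.
  obtain ⟨k, hk⟩ := exists_nat_gt (R / δ)
  refine ⟨((n : ℝ) * n) ^ (k + 1), fun x hx => ?_⟩
  rw [abs_of_pos (hpos x)]
  have hk1 : (0 : ℝ) < (k + 1 : ℕ) := by positivity
  have hx' : |x / (k + 1 : ℕ)| < δ := by
    rw [abs_div, abs_of_pos hk1, div_lt_iff₀ hk1]
    rw [div_lt_iff₀ hδ] at hk
    push_cast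
    nlinarith
  have h := hiter (x / (k + 1 : ℕ)) k
  rw [mul_div_cancel₀ _ hk1.ne'] at h
  exact h.trans (pow_le_pow_left₀ (hpos _).le (hloc _ hx') _)

/-- The growth condition concerns only a neighbourhood of infinity; local boundedness supplies the
rest. The exponent is rounded up to a natural number to match Schwartz decay. -/
theorem PolynomialGrowth.exists_bound {f : ℝ → ℝ} (hf : PolynomialGrowth f)
    (hloc : LocallyBounded f) : ∃ (c : ℝ) (n : ℕ), 0 ≤ c ∧ ∀ x, |f x| ≤ c * (1 + |x|) ^ n := by
  obtain ⟨p, -, hp⟩ := hf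
  obtain ⟨c, hc⟩ := hp.bound
  rw [← Metric.cobounded_eq_cocompact,
    (Metric.hasBasis_cobounded_compl_closedBall (0 : ℝ)).eventually_iff] at hc
  obtain ⟨R, -, hR⟩ := hc
  obtain ⟨B, hB⟩ := hloc R
  refine ⟨max B 0 + |c|, ⌈p⌉₊, by positivity, fun x => ?_⟩
  have h1 : 1 ≤ 1 + |x| := by linarith [abs_nonneg x]
  have h2 : 1 ≤ (1 + |x|) ^ ⌈p⌉₊ := one_le_pow₀ h1
  by_cases hx : |x| ≤ R
  · calc |f x| ≤ (max B 0 + |c|) * 1 := by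
          rw [mul_one]
          exact (hB x hx).trans (by linarith [le_max_left B 0, abs_nonneg c])
      _ ≤ _ := by gcongr
  · have h3 : ‖f x‖ ≤ c * ‖(1 + |x|) ^ p‖ := hR (by simpa using hx)
    rw [Real.norm_eq_abs, Real.norm_of_nonneg (by positivity)] at h3
    calc |f x| ≤ c * (1 + |x|) ^ p := h3
      _ ≤ (max B 0 + |c|) * (1 + |x|) ^ (⌈p⌉₊ : ℝ) := by
          gcongr
          · linarith [le_max_right B 0, le_abs_self c]
          · exact Nat.le_ceil p
      _ = _ := by rw [Real.rpow_natCast]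

/-- The weight that dominates all weights in the kernel estimates. -/
def dominatingWeight (D : Set ℝ) (F v : ℝ → ℝ) (C : ℝ) (u : ℝ) : ℝ :=
  v u * (1 + C * warpWeight D F u + C * warpWeight D F (-u)) ^ 2

/-- `|φ| + |φ'| + |φ''|`. -/
def jetNorm (φ : 𝓢(ℝ, ℂ)) (u : ℝ) : ℝ :=
  ‖φ u‖ + ‖derivCLM ℂ ℂ φ u‖ + ‖derivCLM ℂ ℂ (derivCLM ℂ ℂ φ) u‖

theorem continuous_jetNorm (φ : 𝓢(ℝ, ℂ)) : Continuous (jetNorm φ) :=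
  (φ.continuous.norm.add (derivCLM ℂ ℂ φ).continuous.norm).add
    (derivCLM ℂ ℂ (derivCLM ℂ ℂ φ)).continuous.norm

theorem jetNorm_nonneg (φ : 𝓢(ℝ, ℂ)) (u : ℝ) : 0 ≤ jetNorm φ u := by
  unfold jetNorm
  positivity

/-- Windows for which `|θ| + |θ'| + |θ''|` is integrable against the dominating weight. -/
def IsAdmissibleWindow (D : Set ℝ) (F v : ℝ → ℝ) (C : ℝ) (φ : 𝓢(ℝ, ℂ)) : Prop :=
  Integrable fun u => dominatingWeight D F v C u * jetNorm φ u

section Admissible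

variable {D : Set ℝ} {F v : ℝ → ℝ} {C D₁ : ℝ}

theorem WarpBounds.continuous_weight (h : WarpBounds D F v C D₁) : Continuous (warpWeight D F) :=
  h.contDiff.continuous

theorem WarpBounds.measurable_dominatingWeight (h : WarpBounds D F v C D₁) :
    Measurable (dominatingWeight D F v C) := by
  have h1 := h.continuous_weight.measurable
  have h2 : Measurable fun u => warpWeight D F (-u) := h1.comp measurable_neg
  exact h.measurable.mul (((h1.const_mul C).const_add 1).add (h2.const_mul C) |>.pow_const 2)

theorem WarpBounds.dominatingWeight_nonneg (h : WarpBounds D F v C D₁) (u : ℝ) :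
    0 ≤ dominatingWeight D F v C u :=
  mul_nonneg (zero_le_one.trans (h.one_le u)) (sq_nonneg _)

/-- On a bounded set `v` is bounded by the Steinhaus argument and `w` by continuity, so no growth
condition on either is needed. -/
theorem WarpBounds.isAdmissibleWindow_of_hasCompactSupport (h : WarpBounds D F v C D₁)
    {φ : 𝓢(ℝ, ℂ)} (hφ : HasCompactSupport φ) : IsAdmissibleWindow D F v C φ := by
  have hsupp : HasCompactSupport (jetNorm φ) := by
    have h1 : HasCompactSupport (derivCLM ℂ ℂ φ) := hφ.deriv
    have h2 : HasCompactSupport (derivCLM ℂ ℂ (derivCLM ℂ ℂ φ)) := h1.deriv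
    exact (hφ.norm.add h1.norm).add h2.norm
  obtain ⟨R, hR⟩ := hsupp.isCompact.isBounded.subset_closedBall 0
  obtain ⟨B₁, hB₁⟩ := locallyBounded_of_submul h.measurable h.one_le h.symm h.submul R
  obtain ⟨B₂, hB₂⟩ := locallyBounded_of_continuous h.continuous_weight R
  have hw := h.warp.warpWeight_pos
  have hC := h.const_pos
  have hint : Integrable (jetNorm φ) := (continuous_jetNorm φ).integrable_of_hasCompactSupport hsupp
  refine (hint.const_mul (B₁ * (1 + C * B₂ + C * B₂) ^ 2)).mono'
    (h.measurable_dominatingWeight.mul (continuous_jetNorm φ).measurable).aestronglyMeasurable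
    (Eventually.of_forall fun u => ?_)
  rw [Real.norm_of_nonneg (mul_nonneg (h.dominatingWeight_nonneg u) (jetNorm_nonneg φ u))]
  by_cases hu : u ∈ tsupport (jetNorm φ)
  · have hu' : |u| ≤ R := by simpa using hR hu
    have h1 := (le_abs_self _).trans (hB₁ u hu')
    have h2 := (le_abs_self _).trans (hB₂ u hu')
    have h3 := (le_abs_self _).trans (hB₂ (-u) (by rwa [abs_neg]))
    have h4 := zero_le_one.trans (h.one_le u)
    have h5 := (hw u).le
    have h6 := (hw (-u)).le
    have h7 := h4.trans h1
    refine mul_le_mul_of_nonneg_right ?_ (jetNorm_nonneg φ u)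
    unfold dominatingWeight
    gcongr
  · rw [image_eq_zero_of_notMem_tsupport hu, mul_zero, mul_zero]

theorem integrable_pow_mul_schwartz (ψ : 𝓢(ℝ, ℂ)) (n : ℕ) :
    Integrable fun u : ℝ => (1 + |u|) ^ n * ‖ψ u‖ := by
  have h1 := (ψ.integrable_pow_mul volume 0).add (ψ.integrable_pow_mul volume n)
  refine (h1.const_mul (2 ^ (n - 1))).mono'
    (by
      have := ψ.continuous
      exact Continuous.aestronglyMeasurable (by fun_prop)) (Eventually.of_forall fun u => ?_)
  rw [Real.norm_of_nonneg (by positivity)]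
  have h2 := add_pow_le zero_le_one (abs_nonneg u) n
  rw [one_pow] at h2
  calc (1 + |u|) ^ n * ‖ψ u‖ ≤ (2 ^ (n - 1) * (1 + |u| ^ n)) * ‖ψ u‖ := by gcongr
    _ = _ := by simp; ring

theorem WarpBounds.isAdmissibleWindow_of_polynomialGrowth (h : WarpBounds D F v C D₁)
    (hw : PolynomialGrowth (warpWeight D F)) (hv : PolynomialGrowth v) (φ : 𝓢(ℝ, ℂ)) :
    IsAdmissibleWindow D F v C φ := by
  obtain ⟨c₁, n₁, hc₁, hb₁⟩ := hv.exists_bound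
    (locallyBounded_of_submul h.measurable h.one_le h.symm h.submul)
  obtain ⟨c₂, n₂, hc₂, hb₂⟩ := hw.exists_bound (locallyBounded_of_continuous h.continuous_weight)
  have hpos := h.warp.warpWeight_pos
  have hC := h.const_pos
  have hint : Integrable fun u => (1 + |u|) ^ (n₁ + n₂ * 2) * jetNorm φ u := by
    simp only [jetNorm, mul_add]
    exact ((integrable_pow_mul_schwartz φ _).add (integrable_pow_mul_schwartz _ _)).add
      (integrable_pow_mul_schwartz _ _)
  refine (hint.const_mul (c₁ * (1 + C * c₂ + C * c₂) ^ 2)).mono'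
    (h.measurable_dominatingWeight.mul (continuous_jetNorm φ).measurable).aestronglyMeasurable
    (Eventually.of_forall fun u => ?_)
  rw [Real.norm_of_nonneg (mul_nonneg (h.dominatingWeight_nonneg u) (jetNorm_nonneg φ u)),
    ← mul_assoc]
  refine mul_le_mul_of_nonneg_right ?_ (jetNorm_nonneg φ u)
  have h1 := (le_abs_self _).trans (hb₁ u)
  have h2 := (le_abs_self _).trans (hb₂ u)
  have h3 := (le_abs_self _).trans (hb₂ (-u))
  rw [abs_neg] at h3
  have h4 := zero_le_one.trans (h.one_le u)
  have h5 := (hpos u).le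
  have h6 := (hpos (-u)).le
  have h7 : 1 ≤ (1 + |u|) ^ n₂ := one_le_pow₀ (by linarith [abs_nonneg u])
  calc dominatingWeight D F v C u
      ≤ (c₁ * (1 + |u|) ^ n₁) * ((1 + |u|) ^ n₂ + C * (c₂ * (1 + |u|) ^ n₂) +
          C * (c₂ * (1 + |u|) ^ n₂)) ^ 2 := by
        unfold dominatingWeight
        gcongr
    _ = _ := by ring

end Admissible

/-! ### Oscillatory integrals -/

section Oscillatory

variable {D : Set ℝ} {F v : ℝ → ℝ} {C D₁ : ℝ}

/-- `s ↦ e^{2πiηF⁻¹(s)}`. -/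
def warpedCharacter (D : Set ℝ) (F : ℝ → ℝ) (η s : ℝ) : ℂ :=
  (Real.fourierChar (η * warpInv D F s) : ℂ)

theorem norm_warpedCharacter (η s : ℝ) : ‖warpedCharacter D F η s‖ = 1 := Circle.norm_coe _

theorem IsWarpingFunction.continuous_warpedCharacter (hF : IsWarpingFunction D F) (η : ℝ) :
    Continuous (warpedCharacter D F η) := by
  have := hF.continuous_warpInv
  unfold warpedCharacter
  fun_prop

/-- The factor `w` produced by differentiation is the Jacobian of `t = F⁻¹(s)`, which the
oscillatory integrals already carry. -/
theorem IsWarpingFunction.hasDerivAt_warpedCharacter (hF : IsWarpingFunction D F) (η s : ℝ) :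
    HasDerivAt (warpedCharacter D F η)
      (2 * Real.pi * Complex.I * η * (warpWeight D F s * warpedCharacter D F η s)) s := by
  have h := (Real.hasDerivAt_fourierChar (η * warpInv D F s)).scomp s
    ((hF.hasDerivAt_warpInv s).const_mul η)
  convert! h using 1
  simp only [warpedCharacter, Complex.real_smul]
  push_cast
  ring

theorem IsWarpingFunction.integrable_mul_warpedCharacter (hF : IsWarpingFunction D F)
    {g : ℝ → ℂ} (hg : Integrable g) (η : ℝ) :
    Integrable fun s => g s * warpedCharacter D F η s :=
  hg.mul_bdd (c := 1) (hF.continuous_warpedCharacter η).aestronglyMeasurable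
    (Eventually.of_forall fun s => (norm_warpedCharacter η s).le)

/-- There are no boundary terms, because the product and both terms of its derivative are
integrable. -/
theorem IsWarpingFunction.integral_by_parts (hF : IsWarpingFunction D F) {g g' : ℝ → ℂ}
    (hg : ∀ s, HasDerivAt g (g' s) s) (ig : Integrable g) (ig' : Integrable g')
    (igw : Integrable fun s => g s * warpWeight D F s) (η : ℝ) :
    2 * Real.pi * Complex.I * η * ∫ s, g s * warpWeight D F s * warpedCharacter D F η s =
      -∫ s, g' s * warpedCharacter D F η s := by
  have hint : Integrable fun s => g s *
      (2 * Real.pi * Complex.I * η * (warpWeight D F s * warpedCharacter D F η s)) := by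
    refine ((hF.integrable_mul_warpedCharacter igw η).const_mul
      (2 * Real.pi * Complex.I * η)).congr (Eventually.of_forall fun s => ?_)
    ring
  have h := integral_mul_deriv_eq_deriv_mul_of_integrable (fun s _ => hg s)
    (fun s _ => hF.hasDerivAt_warpedCharacter η s) hint
    (hF.integrable_mul_warpedCharacter ig' η) (hF.integrable_mul_warpedCharacter ig η)
  rw [← h, ← integral_const_mul]
  congr 1
  ext s
  ring

/-- Two integrations by parts, applied to `g` and then to `g' / w`, give `c² I₀ = ∫ (g' / w)'
e^{2πiηF⁻¹}` with `c = 2πiη`. Only the second differentiates `w`, and `|w'| ≤ D₁ w` keeps a single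
power of `w` in the denominator. The free scale `r` is later matched to the size of `w` near the
window. -/
theorem WarpBounds.norm_oscillatory_mul_le (h : WarpBounds D F v C D₁) {g g' g'' : ℝ → ℂ}
    (hg : ∀ s, HasDerivAt g (g' s) s) (hg' : ∀ s, HasDerivAt g' (g'' s) s)
    (ig : Integrable g) (ig' : Integrable g')
    (igw : Integrable fun s => g s * warpWeight D F s)
    (ig'w : Integrable fun s => g' s / warpWeight D F s)
    (ig''w : Integrable fun s => g'' s / warpWeight D F s) (η r : ℝ) :
    ‖∫ s, g s * warpWeight D F s * warpedCharacter D F η s‖ * (1 + (r * η) ^ 2) ≤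
      ∫ s, (‖g s‖ * warpWeight D F s +
        r ^ 2 * ((‖g'' s‖ + D₁ * ‖g' s‖) / warpWeight D F s)) := by
  have hF := h.warp
  have hpos := hF.warpWeight_pos
  set w := warpWeight D F with hw
  set c : ℂ := 2 * Real.pi * Complex.I * η with hc
  set ψ : ℝ → ℂ := fun s => g'' s / w s - g' s * (deriv w s : ℝ) / (w s) ^ 2 with hψ
  have hdw : ∀ s, HasDerivAt (fun t => (w t : ℂ)) ((deriv w s : ℝ) : ℂ) s := fun s =>
    ((h.contDiff.differentiable one_ne_zero s).hasDerivAt).ofReal_comp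
  have hwne : ∀ s, (w s : ℂ) ≠ 0 := fun s => by exact_mod_cast (hpos s).ne'
  have hquot : ∀ s, HasDerivAt (fun t => g' t / w t) (ψ s) s := fun s => by
    refine ((hg' s).div (hdw s) (hwne s)).congr_deriv ?_
    simp only [hψ]
    field_simp [hwne s]
  have hψ1 : ∀ s, ‖ψ s‖ ≤ (‖g'' s‖ + D₁ * ‖g' s‖) / w s := fun s => by
    have h1 : ‖g' s * (deriv w s : ℝ) / (w s) ^ 2‖ ≤ D₁ * ‖g' s‖ / w s := by
      rw [norm_div, norm_mul, norm_pow, Complex.norm_real, Complex.norm_real,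
        Real.norm_of_nonneg (hpos s).le, div_le_div_iff₀ (pow_pos (hpos s) 2) (hpos s)]
      calc ‖g' s‖ * ‖deriv w s‖ * w s ≤ ‖g' s‖ * (D₁ * w s) * w s := by
            have := (hpos s).le
            gcongr
            exact h.deriv_le s
        _ = _ := by ring
    calc ‖ψ s‖ ≤ ‖g'' s / w s‖ + ‖g' s * (deriv w s : ℝ) / (w s) ^ 2‖ := norm_sub_le _ _
      _ ≤ ‖g'' s‖ / w s + D₁ * ‖g' s‖ / w s := by
        gcongr
        rw [norm_div, Complex.norm_real, Real.norm_of_nonneg (hpos s).le]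
      _ = _ := by ring
  have iB : Integrable fun s => (‖g'' s‖ + D₁ * ‖g' s‖) / w s := by
    refine (ig''w.norm.add (ig'w.norm.const_mul D₁)).congr (Eventually.of_forall fun s => ?_)
    simp only [Pi.add_apply, norm_div, Complex.norm_real, Real.norm_of_nonneg (hpos s).le]
    ring
  have iψ : Integrable ψ := by
    refine iB.mono' ?_ (Eventually.of_forall hψ1)
    refine (ig''w.1).sub ?_
    have hcd : Continuous (deriv w) := h.contDiff.continuous_deriv le_rfl
    have hcw : Continuous w := h.contDiff.continuous
    have hcq : Continuous fun s => ((deriv w s : ℝ) : ℂ) / (w s : ℂ) ^ 2 :=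
      (Complex.continuous_ofReal.comp hcd).div ((Complex.continuous_ofReal.comp hcw).pow 2)
        fun s => pow_ne_zero 2 (hwne s)
    exact (ig'.1.mul hcq.aestronglyMeasurable).congr
      (Eventually.of_forall fun s => (mul_div_assoc _ _ _).symm)
  have e1 := hF.integral_by_parts hg ig ig' igw η
  have hcancel : ∀ s, g' s / w s * w s = g' s := fun s => div_mul_cancel₀ _ (hwne s)
  have e2 := hF.integral_by_parts hquot ig'w iψ (ig'.congr
    (Eventually.of_forall fun s => (hcancel s).symm)) η
  rw [← hw] at e1 e2
  simp only [hcancel] at e2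
  rw [← hc] at e1 e2
  set I₀ := ∫ s, g s * w s * warpedCharacter D F η s
  have e3 : c ^ 2 * I₀ = ∫ s, ψ s * warpedCharacter D F η s := by
    rw [pow_two, mul_assoc, e1, mul_neg, e2, neg_neg]
  have hn1 : ‖I₀‖ ≤ ∫ s, ‖g s‖ * w s := by
    refine (norm_integral_le_integral_norm _).trans (le_of_eq ?_)
    congr 1
    ext s
    rw [norm_mul, norm_mul, norm_warpedCharacter, mul_one, Complex.norm_real,
      Real.norm_of_nonneg (hpos s).le]
  have hn2 : η ^ 2 * ‖I₀‖ ≤ ∫ s, (‖g'' s‖ + D₁ * ‖g' s‖) / w s := by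
    -- The surplus factor `4π²` is discarded.
    calc η ^ 2 * ‖I₀‖ ≤ ‖c‖ ^ 2 * ‖I₀‖ := by
          have hcn : ‖c‖ = 2 * Real.pi * |η| := by
            rw [hc]
            simp [abs_of_pos Real.pi_pos]
          refine mul_le_mul_of_nonneg_right ?_ (norm_nonneg _)
          rw [hcn, ← sq_abs η]
          refine pow_le_pow_left₀ (abs_nonneg η) ?_ 2
          have := Real.pi_gt_three
          nlinarith [abs_nonneg η]
      _ = ‖c ^ 2 * I₀‖ := by rw [norm_mul (c ^ 2), norm_pow c]
      _ = ‖∫ s, ψ s * warpedCharacter D F η s‖ := by rw [e3]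
      _ ≤ ∫ s, ‖ψ s * warpedCharacter D F η s‖ := norm_integral_le_integral_norm _
      _ = ∫ s, ‖ψ s‖ := by simp only [norm_mul, norm_warpedCharacter, mul_one]
      _ ≤ _ := integral_mono iψ.norm iB hψ1
  have igw' : Integrable fun s => ‖g s‖ * w s := by
    refine igw.norm.congr (Eventually.of_forall fun s => ?_)
    simp only [norm_mul, Complex.norm_real, Real.norm_of_nonneg (hpos s).le]
  rw [integral_add igw' (iB.const_mul _), integral_const_mul]
  calc ‖I₀‖ * (1 + (r * η) ^ 2) = ‖I₀‖ + r ^ 2 * (η ^ 2 * ‖I₀‖) := by ring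
    _ ≤ _ := by gcongr

theorem lintegral_inv_one_add_sq {r : ℝ} (hr : 0 < r) :
    ∫⁻ η : ℝ, ENNReal.ofReal (1 + (r * η) ^ 2)⁻¹ = ENNReal.ofReal (Real.pi / r) := by
  have hint : Integrable fun η : ℝ => (1 + (r * η) ^ 2)⁻¹ :=
    integrable_inv_one_add_sq.comp_mul_left' hr.ne'
  rw [← ofReal_integral_eq_lintegral_ofReal hint (Eventually.of_forall fun η => by positivity)]
  have h := Measure.integral_comp_mul_left (fun x : ℝ => (1 + x ^ 2)⁻¹) r
  rw [h, integral_univ_inv_one_add_sq, abs_of_pos (inv_pos.2 hr), smul_eq_mul]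
  congr 1
  ring

end Oscillatory

/-! ### Products of translated windows -/

section WindowProduct

variable {D : Set ℝ} {F v : ℝ → ℝ} {C D₁ : ℝ}

/-- `conj θ₁(s - a) θ₂(s - b)`. -/
def windowProduct (φ₁ φ₂ : 𝓢(ℝ, ℂ)) (a b s : ℝ) : ℂ := star (φ₁ (s - a)) * φ₂ (s - b)

theorem hasDerivAt_windowProduct (φ₁ φ₂ : 𝓢(ℝ, ℂ)) (a b s : ℝ) :
    HasDerivAt (windowProduct φ₁ φ₂ a b) (windowProduct (derivCLM ℂ ℂ φ₁) φ₂ a b s +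
      windowProduct φ₁ (derivCLM ℂ ℂ φ₂) a b s) s := by
  have h : ∀ (φ : 𝓢(ℝ, ℂ)) (c : ℝ),
      HasDerivAt (fun t => φ (t - c)) (derivCLM ℂ ℂ φ (s - c)) s := fun φ c =>
    HasDerivAt.comp_sub_const s c (φ.differentiableAt.hasDerivAt)
  exact (h φ₁ a).star.mul (h φ₂ b)

theorem continuous_windowProduct (φ₁ φ₂ : 𝓢(ℝ, ℂ)) (a b : ℝ) :
    Continuous (windowProduct φ₁ φ₂ a b) :=
  continuous_iff_continuousAt.2 fun s => (hasDerivAt_windowProduct φ₁ φ₂ a b s).continuousAt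

theorem norm_windowProduct (φ₁ φ₂ : 𝓢(ℝ, ℂ)) (a b s : ℝ) :
    ‖windowProduct φ₁ φ₂ a b s‖ = ‖φ₁ (s - a)‖ * ‖φ₂ (s - b)‖ := by
  rw [windowProduct, norm_mul, norm_star]

/-- A bound for all quantities in the oscillatory integral estimate. -/
def productBound (D : Set ℝ) (F : ℝ → ℝ) (C : ℝ) (φ₁ φ₂ : 𝓢(ℝ, ℂ)) (a b s : ℝ) : ℝ :=
  jetNorm φ₁ (s - a) * jetNorm φ₂ (s - b) *
    (1 + C * warpWeight D F (s - a) + C * warpWeight D F (a - s))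

theorem exists_norm_schwartz_le (φ : 𝓢(ℝ, ℂ)) : ∃ K, ∀ u, ‖φ u‖ ≤ K := by
  obtain ⟨K, hK⟩ := φ.decay 0 0
  exact ⟨K, fun u => by simpa using hK.2 u⟩

theorem exists_jetNorm_le (φ : 𝓢(ℝ, ℂ)) : ∃ K, ∀ u, jetNorm φ u ≤ K := by
  obtain ⟨K₀, h₀⟩ := exists_norm_schwartz_le φ
  obtain ⟨K₁, h₁⟩ := exists_norm_schwartz_le (derivCLM ℂ ℂ φ)
  obtain ⟨K₂, h₂⟩ := exists_norm_schwartz_le (derivCLM ℂ ℂ (derivCLM ℂ ℂ φ))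
  exact ⟨K₀ + K₁ + K₂, fun u => add_le_add (add_le_add (h₀ u) (h₁ u)) (h₂ u)⟩

theorem WarpBounds.weight_factor_one_le (h : WarpBounds D F v C D₁) (u : ℝ) :
    1 ≤ 1 + C * warpWeight D F u + C * warpWeight D F (-u) := by
  have h1 := mul_pos h.const_pos (h.warp.warpWeight_pos u)
  have h2 := mul_pos h.const_pos (h.warp.warpWeight_pos (-u))
  linarith

theorem WarpBounds.weight_factor_le (h : WarpBounds D F v C D₁) (u : ℝ) :
    1 + C * warpWeight D F u + C * warpWeight D F (-u) ≤ dominatingWeight D F v C u := by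
  have h1 := h.weight_factor_one_le u
  have h2 := h.one_le u
  unfold dominatingWeight
  nlinarith

theorem WarpBounds.productBound_nonneg (h : WarpBounds D F v C D₁) (φ₁ φ₂ : 𝓢(ℝ, ℂ))
    (a b s : ℝ) : 0 ≤ productBound D F C φ₁ φ₂ a b s := by
  have h1 := h.weight_factor_one_le (s - a)
  rw [neg_sub] at h1
  exact mul_nonneg (mul_nonneg (jetNorm_nonneg _ _) (jetNorm_nonneg _ _))
    (zero_le_one.trans h1)

theorem WarpBounds.continuous_productBound (h : WarpBounds D F v C D₁) (φ₁ φ₂ : 𝓢(ℝ, ℂ)) (a : ℝ) :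
    Continuous fun p : ℝ × ℝ => productBound D F C φ₁ φ₂ a p.1 p.2 := by
  have h1 := h.continuous_weight
  have h2 := continuous_jetNorm φ₁
  have h3 := continuous_jetNorm φ₂
  unfold productBound
  fun_prop

/-- The second window is bounded by its supremum, so admissibility of the first suffices. -/
theorem WarpBounds.integrable_productBound (h : WarpBounds D F v C D₁) {φ₁ φ₂ : 𝓢(ℝ, ℂ)}
    (h₁ : IsAdmissibleWindow D F v C φ₁) (a b : ℝ) :
    Integrable (productBound D F C φ₁ φ₂ a b) := by
  obtain ⟨K, hK⟩ := exists_jetNorm_le φ₂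
  have hint := (h₁.comp_sub_right a).const_mul K
  refine hint.mono' ?_ (Eventually.of_forall fun s => ?_)
  · exact ((h.continuous_productBound φ₁ φ₂ a).comp
      (Continuous.prodMk_right b)).aestronglyMeasurable
  · rw [Real.norm_of_nonneg (h.productBound_nonneg _ _ _ _ _)]
    have e1 := h.weight_factor_le (s - a)
    have e2 := h.weight_factor_one_le (s - a)
    rw [neg_sub] at e1 e2
    have e3 := hK (s - b)
    have e4 := jetNorm_nonneg φ₁ (s - a)
    have e5 := (jetNorm_nonneg φ₂ (s - b)).trans e3
    calc productBound D F C φ₁ φ₂ a b s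
        ≤ jetNorm φ₁ (s - a) * K * dominatingWeight D F v C (s - a) := by
          unfold productBound
          gcongr
      _ = _ := by ring

/-- From `w(s) ≤ C w(s - a) w(a)`. The factor is symmetrized in `s - a` so that it also bounds `w(a)
/ w(s)`, with the roles of `a` and `s` exchanged. -/
theorem WarpBounds.weight_le (h : WarpBounds D F v C D₁) (a s : ℝ) :
    warpWeight D F s ≤ warpWeight D F a *
      (1 + C * warpWeight D F (s - a) + C * warpWeight D F (a - s)) := by
  have h1 := h.weight_add (s - a) a
  rw [sub_add_cancel] at h1
  have h2 := h.warp.warpWeight_pos a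
  have h3 := mul_pos h.const_pos (h.warp.warpWeight_pos (a - s))
  nlinarith

theorem WarpBounds.weight_div_le (h : WarpBounds D F v C D₁) (a s : ℝ) :
    warpWeight D F a / warpWeight D F s ≤
      1 + C * warpWeight D F (s - a) + C * warpWeight D F (a - s) := by
  rw [div_le_iff₀ (h.warp.warpWeight_pos s), mul_comm]
  have := h.weight_le s a
  linarith

/-- Leibniz terms of order zero, one and two all occur in the product of the jets; the `2` accounts
for the mixed second-order term, which appears twice. -/
theorem jet_products_le (φ₁ φ₂ : 𝓢(ℝ, ℂ)) (x y : ℝ) :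
    ‖φ₁ x‖ * ‖φ₂ y‖ ≤ jetNorm φ₁ x * jetNorm φ₂ y ∧
    ‖derivCLM ℂ ℂ φ₁ x‖ * ‖φ₂ y‖ + ‖φ₁ x‖ * ‖derivCLM ℂ ℂ φ₂ y‖ ≤
      jetNorm φ₁ x * jetNorm φ₂ y ∧
    ‖derivCLM ℂ ℂ (derivCLM ℂ ℂ φ₁) x‖ * ‖φ₂ y‖ +
      ‖derivCLM ℂ ℂ φ₁ x‖ * ‖derivCLM ℂ ℂ φ₂ y‖ +
      (‖derivCLM ℂ ℂ φ₁ x‖ * ‖derivCLM ℂ ℂ φ₂ y‖ +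
        ‖φ₁ x‖ * ‖derivCLM ℂ ℂ (derivCLM ℂ ℂ φ₂) y‖) ≤ 2 * (jetNorm φ₁ x * jetNorm φ₂ y) := by
  unfold jetNorm
  have p₀ := norm_nonneg (φ₁ x)
  have p₁ := norm_nonneg (derivCLM ℂ ℂ φ₁ x)
  have p₂ := norm_nonneg (derivCLM ℂ ℂ (derivCLM ℂ ℂ φ₁) x)
  have q₀ := norm_nonneg (φ₂ y)
  have q₁ := norm_nonneg (derivCLM ℂ ℂ φ₂ y)
  have q₂ := norm_nonneg (derivCLM ℂ ℂ (derivCLM ℂ ℂ φ₂) y)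
  have h00 := mul_nonneg p₀ q₀
  have h01 := mul_nonneg p₀ q₁
  have h02 := mul_nonneg p₀ q₂
  have h10 := mul_nonneg p₁ q₀
  have h11 := mul_nonneg p₁ q₁
  have h12 := mul_nonneg p₁ q₂
  have h20 := mul_nonneg p₂ q₀
  have h21 := mul_nonneg p₂ q₁
  have h22 := mul_nonneg p₂ q₂
  refine ⟨?_, ?_, ?_⟩ <;> linarith

/-- The scale is `r = w(a)`. Then both `P w` and `r² P / w` are at most `w(a)` times the product
bound; the constant is `1` from the undifferentiated term, `2` from `g''` and `D₁` from `g'`. -/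
theorem WarpBounds.norm_oscillatory_window_le (h : WarpBounds D F v C D₁) {φ₁ φ₂ : 𝓢(ℝ, ℂ)}
    (h₁ : IsAdmissibleWindow D F v C φ₁) (a b η : ℝ) :
    ‖∫ s, windowProduct φ₁ φ₂ a b s * warpWeight D F s * warpedCharacter D F η s‖ *
      (1 + (warpWeight D F a * η) ^ 2) ≤
    warpWeight D F a * (3 + D₁) * ∫ s, productBound D F C φ₁ φ₂ a b s := by
  have hpos := h.warp.warpWeight_pos
  set w := warpWeight D F with hw
  set B := productBound D F C φ₁ φ₂ a b with hB
  have iB : Integrable B := h.integrable_productBound h₁ a b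
  set g := windowProduct φ₁ φ₂ a b with hg
  set g' := fun s => windowProduct (derivCLM ℂ ℂ φ₁) φ₂ a b s +
    windowProduct φ₁ (derivCLM ℂ ℂ φ₂) a b s with hg'
  set g'' := fun s => (windowProduct (derivCLM ℂ ℂ (derivCLM ℂ ℂ φ₁)) φ₂ a b s +
    windowProduct (derivCLM ℂ ℂ φ₁) (derivCLM ℂ ℂ φ₂) a b s) +
    (windowProduct (derivCLM ℂ ℂ φ₁) (derivCLM ℂ ℂ φ₂) a b s +
    windowProduct φ₁ (derivCLM ℂ ℂ (derivCLM ℂ ℂ φ₂)) a b s) with hg''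
  have d0 : ∀ s, HasDerivAt g (g' s) s := hasDerivAt_windowProduct φ₁ φ₂ a b
  have d1 : ∀ s, HasDerivAt g' (g'' s) s := fun s =>
    (hasDerivAt_windowProduct _ _ a b s).add (hasDerivAt_windowProduct _ _ a b s)
  set P := fun s => jetNorm φ₁ (s - a) * jetNorm φ₂ (s - b) with hP
  have hP0 : ∀ s, 0 ≤ P s := fun s => mul_nonneg (jetNorm_nonneg _ _) (jetNorm_nonneg _ _)
  have n0 : ∀ s, ‖g s‖ ≤ P s := fun s => by
    rw [hg, norm_windowProduct]
    exact (jet_products_le φ₁ φ₂ _ _).1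
  have n1 : ∀ s, ‖g' s‖ ≤ P s := fun s => by
    refine (norm_add_le _ _).trans ?_
    simp only [norm_windowProduct]
    exact (jet_products_le φ₁ φ₂ _ _).2.1
  have n2 : ∀ s, ‖g'' s‖ ≤ 2 * P s := fun s => by
    refine (norm_add_le _ _).trans ((add_le_add (norm_add_le _ _) (norm_add_le _ _)).trans ?_)
    simp only [norm_windowProduct]
    exact (jet_products_le φ₁ φ₂ _ _).2.2
  have hBP : ∀ s, B s = P s * (1 + C * w (s - a) + C * w (a - s)) := fun s => rfl
  have b0 : ∀ s, P s ≤ B s := fun s => by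
    have := h.weight_factor_one_le (s - a)
    rw [neg_sub] at this
    rw [hBP]
    exact le_mul_of_one_le_right (hP0 s) this
  have b1 : ∀ s, P s * w s ≤ w a * B s := fun s => by
    rw [hBP]
    calc P s * w s ≤ P s * (w a * (1 + C * w (s - a) + C * w (a - s))) := by
          have := hP0 s
          gcongr
          exact h.weight_le a s
      _ = _ := by ring
  have b2 : ∀ s, P s * (w a / w s) ≤ B s := fun s => by
    rw [hBP]
    have := hP0 s
    gcongr
    exact h.weight_div_le a s
  have b2' : ∀ s, P s / w s ≤ (w a)⁻¹ * B s := fun s => by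
    have e : P s / w s = (w a)⁻¹ * (P s * (w a / w s)) := by
      field_simp [(hpos a).ne', (hpos s).ne']
    rw [e]
    have := (inv_pos.2 (hpos a)).le
    gcongr
    exact b2 s
  have cw : Continuous fun s => (w s : ℂ) := Complex.continuous_ofReal.comp h.continuous_weight
  have hwne : ∀ s, (w s : ℂ) ≠ 0 := fun s => by exact_mod_cast (hpos s).ne'
  have c0 : Continuous g := continuous_windowProduct _ _ _ _
  have c1 : Continuous g' :=
    (continuous_windowProduct _ _ _ _).add (continuous_windowProduct _ _ _ _)
  have c2 : Continuous g'' :=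
    ((continuous_windowProduct _ _ _ _).add (continuous_windowProduct _ _ _ _)).add
      ((continuous_windowProduct _ _ _ _).add (continuous_windowProduct _ _ _ _))
  have nw : ∀ s, ‖(w s : ℂ)‖ = w s := fun s => by
    rw [Complex.norm_real, Real.norm_of_nonneg (hpos s).le]
  have ig : Integrable g := iB.mono' c0.aestronglyMeasurable
    (Eventually.of_forall fun s => (n0 s).trans (b0 s))
  have ig' : Integrable g' := iB.mono' c1.aestronglyMeasurable
    (Eventually.of_forall fun s => (n1 s).trans (b0 s))
  have igw : Integrable fun s => g s * w s :=
    (iB.const_mul (w a)).mono' (c0.mul cw).aestronglyMeasurable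
    (Eventually.of_forall fun s => by
      rw [norm_mul, nw]
      exact (mul_le_mul_of_nonneg_right (n0 s) (hpos s).le).trans (b1 s))
  have ig'w : Integrable fun s => g' s / w s :=
    (iB.const_mul (w a)⁻¹).mono' (c1.div cw hwne).aestronglyMeasurable
    (Eventually.of_forall fun s => by
      rw [norm_div, nw]
      exact (div_le_div_of_nonneg_right (n1 s) (hpos s).le).trans (b2' s))
  have ig''w : Integrable fun s => g'' s / w s :=
    ((iB.const_mul (w a)⁻¹).const_mul 2).mono' (c2.div cw hwne).aestronglyMeasurable
    (Eventually.of_forall fun s => by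
      rw [norm_div, nw]
      refine (div_le_div_of_nonneg_right (n2 s) (hpos s).le).trans ?_
      rw [mul_div_assoc]
      exact mul_le_mul_of_nonneg_left (b2' s) zero_le_two)
  refine (h.norm_oscillatory_mul_le d0 d1 ig ig' igw ig'w ig''w η (w a)).trans ?_
  rw [← integral_const_mul]
  refine integral_mono_of_nonneg (Eventually.of_forall fun s => ?_) (iB.const_mul _)
    (Eventually.of_forall fun s => ?_)
  · have := (hpos s).le
    have := h.const_nonneg
    simp only [Pi.zero_apply]
    positivity
  · have hs := hpos s
    have ha := hpos a
    have hD := h.const_nonneg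
    beta_reduce
    calc ‖g s‖ * w s + w a ^ 2 * ((‖g'' s‖ + D₁ * ‖g' s‖) / w s)
        ≤ P s * w s + w a ^ 2 * ((2 * P s + D₁ * P s) / w s) := by
          gcongr
          · exact n0 s
          · exact n2 s
          · exact n1 s
      _ = P s * w s + w a * (2 + D₁) * (P s * (w a / w s)) := by
          field_simp
      _ ≤ w a * B s + w a * (2 + D₁) * B s := by
          have := mul_nonneg ha.le (add_nonneg zero_le_two hD)
          exact add_le_add (b1 s) (mul_le_mul_of_nonneg_left (b2 s) this)
      _ = _ := by ring

/-- Integrating the decay factor gives `π / w(a)`, which cancels the prefactor `w(a)`; the constant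
no longer depends on `a`. -/
theorem WarpBounds.lintegral_oscillatory_window_le (h : WarpBounds D F v C D₁)
    {φ₁ φ₂ : 𝓢(ℝ, ℂ)} (h₁ : IsAdmissibleWindow D F v C φ₁) (a b : ℝ) :
    ∫⁻ η, ‖∫ s, windowProduct φ₁ φ₂ a b s * warpWeight D F s * warpedCharacter D F η s‖ₑ ≤
      ENNReal.ofReal (Real.pi * (3 + D₁)) *
        ∫⁻ s, ENNReal.ofReal (productBound D F C φ₁ φ₂ a b s) := by
  have ha := h.warp.warpWeight_pos a
  have hD := h.const_nonneg
  rw [← ofReal_integral_eq_lintegral_ofReal (h.integrable_productBound h₁ a b)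
    (Eventually.of_forall fun s => h.productBound_nonneg _ _ _ _ _),
    ← ENNReal.ofReal_mul (by positivity)]
  set Q := ∫ s, productBound D F C φ₁ φ₂ a b s with hQ
  have hQ0 : 0 ≤ Q := integral_nonneg fun s => h.productBound_nonneg _ _ _ _ _
  calc ∫⁻ η, ‖∫ s, windowProduct φ₁ φ₂ a b s * warpWeight D F s * warpedCharacter D F η s‖ₑ
      ≤ ∫⁻ η : ℝ, ENNReal.ofReal (warpWeight D F a * (3 + D₁) * Q) *
          ENNReal.ofReal (1 + (warpWeight D F a * η) ^ 2)⁻¹ := by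
        apply lintegral_mono
        intro η
        beta_reduce
        rw [← ofReal_norm, ← ENNReal.ofReal_mul (by positivity)]
        apply ENNReal.ofReal_le_ofReal
        rw [← div_eq_mul_inv, le_div_iff₀ (by positivity)]
        exact h.norm_oscillatory_window_le h₁ a b η
    _ = _ := by
        rw [lintegral_const_mul' _ _ ENNReal.ofReal_ne_top, lintegral_inv_one_add_sq ha,
          ← ENNReal.ofReal_mul (by positivity)]
        congr 1
        field_simp

/-- Write `b - a = (s - a) - (s - b)` and distribute the weights over the two windows. The first
window receives one weight factor from the splitting and one from `productBound`, whence the square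
in `dominatingWeight`. -/
theorem WarpBounds.productBound_mul_le (h : WarpBounds D F v C D₁) (φ₁ φ₂ : 𝓢(ℝ, ℂ))
    (a b s : ℝ) :
    v (b - a) * (1 + C * warpWeight D F (b - a)) * productBound D F C φ₁ φ₂ a b s ≤
      (dominatingWeight D F v C (s - a) * jetNorm φ₁ (s - a)) *
      (dominatingWeight D F v C (s - b) * jetNorm φ₂ (s - b)) := by
  have hpos := h.warp.warpWeight_pos
  have hC := h.const_pos
  have hv : v (b - a) ≤ v (s - a) * v (s - b) := by
    have e := h.submul (s - a) (-(s - b))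
    rw [h.symm] at e
    convert! e using 2
    ring
  have hw : 1 + C * warpWeight D F (b - a) ≤
      (1 + C * warpWeight D F (s - a)) * (1 + C * warpWeight D F (b - s)) := by
    have e := h.weight_add (s - a) (b - s)
    rw [show s - a + (b - s) = b - a by ring] at e
    have e1 := mul_pos hC (hpos (s - a))
    have e2 := mul_pos hC (hpos (b - s))
    nlinarith
  have p1 := mul_pos hC (hpos (s - a))
  have p2 := mul_pos hC (hpos (a - s))
  have p3 := mul_pos hC (hpos (b - s))
  have p4 := mul_pos hC (hpos (s - b))
  have p5 := mul_pos hC (hpos (b - a))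
  have v1 := zero_le_one.trans (h.one_le (s - a))
  have v2 := zero_le_one.trans (h.one_le (s - b))
  have j1 := jetNorm_nonneg φ₁ (s - a)
  have j2 := jetNorm_nonneg φ₂ (s - b)
  have q0 : 0 ≤ 1 + C * warpWeight D F (s - a) + C * warpWeight D F (a - s) := by linarith
  have q1 : (1 + C * warpWeight D F (s - a)) *
      (1 + C * warpWeight D F (s - a) + C * warpWeight D F (a - s)) ≤
      (1 + C * warpWeight D F (s - a) + C * warpWeight D F (a - s)) ^ 2 := by
    rw [pow_two]
    exact mul_le_mul_of_nonneg_right (by linarith) q0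
  have q2 : 1 + C * warpWeight D F (b - s) ≤
      (1 + C * warpWeight D F (s - b) + C * warpWeight D F (b - s)) ^ 2 := by
    nlinarith
  unfold productBound dominatingWeight
  rw [neg_sub, neg_sub]
  set W₁ := 1 + C * warpWeight D F (s - a) + C * warpWeight D F (a - s)
  set W₂ := 1 + C * warpWeight D F (s - b) + C * warpWeight D F (b - s)
  calc v (b - a) * (1 + C * warpWeight D F (b - a)) *
        (jetNorm φ₁ (s - a) * jetNorm φ₂ (s - b) * W₁)
      ≤ (v (s - a) * v (s - b)) *
        ((1 + C * warpWeight D F (s - a)) * (1 + C * warpWeight D F (b - s))) *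
        (jetNorm φ₁ (s - a) * jetNorm φ₂ (s - b) * W₁) := by gcongr
    _ = v (s - a) * v (s - b) * jetNorm φ₁ (s - a) * jetNorm φ₂ (s - b) *
        (((1 + C * warpWeight D F (s - a)) * W₁) * (1 + C * warpWeight D F (b - s))) := by ring
    _ ≤ v (s - a) * v (s - b) * jetNorm φ₁ (s - a) * jetNorm φ₂ (s - b) *
        (W₁ ^ 2 * W₂ ^ 2) := by gcongr
    _ = _ := by ring

/-- After the weights are split, integrating first in `b` and then in `s` decouples the windows by
translation and reflection invariance, uniformly in `a`. -/
theorem WarpBounds.lintegral_productBound_le (h : WarpBounds D F v C D₁) (φ₁ φ₂ : 𝓢(ℝ, ℂ))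
    (a : ℝ) :
    ∫⁻ b, ENNReal.ofReal (v (b - a) * (1 + C * warpWeight D F (b - a))) *
        ∫⁻ s, ENNReal.ofReal (productBound D F C φ₁ φ₂ a b s) ≤
      (∫⁻ u, ENNReal.ofReal (dominatingWeight D F v C u * jetNorm φ₁ u)) *
      ∫⁻ u, ENNReal.ofReal (dominatingWeight D F v C u * jetNorm φ₂ u) := by
  have hm : ∀ φ, Measurable fun u => ENNReal.ofReal (dominatingWeight D F v C u * jetNorm φ u) :=
    fun φ => (h.measurable_dominatingWeight.mul (continuous_jetNorm φ).measurable).ennreal_ofReal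
  have hpos := h.warp.warpWeight_pos
  have hC := h.const_pos
  calc _ ≤ ∫⁻ b, ∫⁻ s, ENNReal.ofReal (dominatingWeight D F v C (s - a) * jetNorm φ₁ (s - a)) *
        ENNReal.ofReal (dominatingWeight D F v C (s - b) * jetNorm φ₂ (s - b)) := by
        refine lintegral_mono fun b => ?_
        rw [← lintegral_const_mul' _ _ ENNReal.ofReal_ne_top]
        refine lintegral_mono fun s => ?_
        have h1 := zero_le_one.trans (h.one_le (b - a))
        have h2 := mul_pos hC (hpos (b - a))
        rw [← ENNReal.ofReal_mul (by positivity), ← ENNReal.ofReal_mul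
          (mul_nonneg (h.dominatingWeight_nonneg _) (jetNorm_nonneg _ _))]
        exact ENNReal.ofReal_le_ofReal (h.productBound_mul_le φ₁ φ₂ a b s)
    _ = ∫⁻ s, ENNReal.ofReal (dominatingWeight D F v C (s - a) * jetNorm φ₁ (s - a)) *
        ∫⁻ b, ENNReal.ofReal (dominatingWeight D F v C (s - b) * jetNorm φ₂ (s - b)) := by
        rw [lintegral_lintegral_swap]
        · congr 1
          ext s
          rw [lintegral_const_mul' _ _ ENNReal.ofReal_ne_top]
        · exact (((hm φ₁).comp (measurable_snd.sub_const a)).mul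
            ((hm φ₂).comp (measurable_snd.sub measurable_fst))).aemeasurable
    _ = ∫⁻ s, ENNReal.ofReal (dominatingWeight D F v C (s - a) * jetNorm φ₁ (s - a)) *
        ∫⁻ u, ENNReal.ofReal (dominatingWeight D F v C u * jetNorm φ₂ u) := by
        congr 1
        ext s
        rw [lintegral_sub_left_eq_self (μ := volume)
          (fun u => ENNReal.ofReal (dominatingWeight D F v C u * jetNorm φ₂ u)) s]
    _ = _ := by
        have hma : Measurable fun s =>
            ENNReal.ofReal (dominatingWeight D F v C (s - a) * jetNorm φ₁ (s - a)) :=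
          (hm φ₁).comp (measurable_id.sub_const a)
        rw [lintegral_mul_const _ hma,
          lintegral_sub_right_eq_self (μ := volume)
          (fun u => ENNReal.ofReal (dominatingWeight D F v C u * jetNorm φ₁ u)) a]

end WindowProduct

/-! ### The warped system as a continuous tight frame -/

section WarpedFrame

variable {D : Set ℝ} {F v : ℝ → ℝ} {C D₁ : ℝ} {φ : 𝓢(ℝ, ℂ)}

theorem IsWarpingFunction.measurable_warpedProfile (hF : IsWarpingFunction D F) (φ : 𝓢(ℝ, ℂ))
    (x : ℝ) : Measurable (warpedProfile D F φ x) := by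
  classical
  rw [warpedProfile, ← piecewise_eq_indicator]
  refine ContinuousOn.measurable_piecewise ?_ continuousOn_const hF.isOpen.measurableSet
  exact continuousOn_const.mul (φ.continuous.comp_continuousOn
    (hF.contDiffOn.continuousOn.sub continuousOn_const))

theorem WarpBounds.weight_ratio_le (h : WarpBounds D F v C D₁) (a s : ℝ) :
    warpWeight D F s * (warpWeight D F a)⁻¹ ≤ C * warpWeight D F (s - a) := by
  have h1 := h.weight_add (s - a) a
  rw [sub_add_cancel] at h1
  rw [← div_eq_mul_inv, div_le_iff₀ (h.warp.warpWeight_pos a)]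
  linarith

theorem enorm_warpedProfile_sq (hF : IsWarpingFunction D F) {x t : ℝ} (ht : t ∈ D) (hx : x ∈ D) :
    ‖warpedProfile D F φ x t‖ₑ ^ 2 =
      ENNReal.ofReal (warpWeight D F (F x))⁻¹ * ‖φ (F t - F x)‖ₑ ^ 2 := by
  rw [warpedProfile, indicator_of_mem ht, enorm_mul, mul_pow, enorm_complex_ofReal,
    Real.enorm_of_nonneg (Real.sqrt_nonneg _), ← ENNReal.ofReal_pow (Real.sqrt_nonneg _),
    Real.sq_sqrt (hF.deriv_pos x hx).le, hF.deriv_eq hx]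

/-- In the variable `s = F(t)` the density is `w(s) / w(F(x)) ≤ C w(s - F(x))`, so translation
removes all dependence on `x`. -/
theorem WarpBounds.lintegral_warpedProfile_sq_le (h : WarpBounds D F v C D₁) (φ : 𝓢(ℝ, ℂ))
    {x : ℝ} (hx : x ∈ D) :
    ∫⁻ t, ‖warpedProfile D F φ x t‖ₑ ^ 2 ≤
      ∫⁻ u, ENNReal.ofReal (C * warpWeight D F u) * ‖φ u‖ₑ ^ 2 := by
  have hF := h.warp
  calc ∫⁻ t, ‖warpedProfile D F φ x t‖ₑ ^ 2
      = ∫⁻ t in D, ‖warpedProfile D F φ x t‖ₑ ^ 2 := by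
        refine (setLIntegral_eq_of_support_subset ?_).symm
        intro t ht
        by_contra hD
        exact ht (by simp [warpedProfile, indicator_of_notMem hD])
    _ = ∫⁻ s, ENNReal.ofReal (warpWeight D F s) *
          (ENNReal.ofReal (warpWeight D F (F x))⁻¹ * ‖φ (s - F x)‖ₑ ^ 2) := by
        rw [hF.lintegral_eq]
        congr 1
        ext s
        rw [enorm_warpedProfile_sq hF (hF.warpInv_mem s) hx, hF.apply_warpInv]
    _ ≤ ∫⁻ s, ENNReal.ofReal (C * warpWeight D F (s - F x)) * ‖φ (s - F x)‖ₑ ^ 2 := by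
        refine lintegral_mono fun s => ?_
        rw [← mul_assoc, ← ENNReal.ofReal_mul (hF.warpWeight_pos s).le]
        exact mul_le_mul_left (ENNReal.ofReal_le_ofReal (h.weight_ratio_le _ _)) _
    _ = _ := lintegral_sub_right_eq_self (μ := volume)
        (fun u => ENNReal.ofReal (C * warpWeight D F u) * ‖φ u‖ₑ ^ 2) (F x)

theorem WarpBounds.lintegral_weight_sq_lt_top (h : WarpBounds D F v C D₁)
    (hφ : IsAdmissibleWindow D F v C φ) :
    ∫⁻ u, ENNReal.ofReal (C * warpWeight D F u) * ‖φ u‖ₑ ^ 2 < ⊤ := by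
  obtain ⟨K, hK⟩ := exists_jetNorm_le φ
  have hint := (hφ.const_mul K).2
  refine lt_of_le_of_lt (lintegral_mono fun u => ?_) hint
  have h1 := mul_pos h.const_pos (h.warp.warpWeight_pos u)
  have h2 := mul_pos h.const_pos (h.warp.warpWeight_pos (-u))
  have h3 := h.weight_factor_le u
  have h4 : ‖φ u‖ ≤ jetNorm φ u := by
    unfold jetNorm
    linarith [norm_nonneg (derivCLM ℂ ℂ φ u), norm_nonneg (derivCLM ℂ ℂ (derivCLM ℂ ℂ φ) u)]
  have h5 := hK u
  have h6 := (norm_nonneg (φ u)).trans (h4.trans h5)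
  rw [Real.enorm_eq_ofReal_abs, ← ofReal_norm, ← ENNReal.ofReal_pow (norm_nonneg _),
    ← ENNReal.ofReal_mul h1.le]
  refine ENNReal.ofReal_le_ofReal (le_trans ?_ (le_abs_self _))
  have h7 := h.dominatingWeight_nonneg u
  calc C * warpWeight D F u * ‖φ u‖ ^ 2
      ≤ dominatingWeight D F v C u * (jetNorm φ u * K) := by
        rw [pow_two]
        refine mul_le_mul (by linarith) ?_ (by positivity) h7
        exact mul_le_mul h4 (h4.trans h5) (norm_nonneg _) (jetNorm_nonneg φ u)
    _ = _ := by ring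

theorem WarpBounds.memLp_warpedProfile (h : WarpBounds D F v C D₁)
    (hφ : IsAdmissibleWindow D F v C φ) {x : ℝ} (hx : x ∈ D) :
    MemLp (warpedProfile D F φ x) 2 volume := by
  refine ⟨(h.warp.measurable_warpedProfile φ x).aestronglyMeasurable, ?_⟩
  rw [eLpNorm_eq_lintegral_rpow_enorm_toReal (by norm_num) (by norm_num)]
  apply ENNReal.rpow_lt_top_of_nonneg (by positivity)
  simp only [ENNReal.toReal_ofNat, ENNReal.rpow_ofNat]
  exact ((h.lintegral_warpedProfile_sq_le φ hx).trans_lt (h.lintegral_weight_sq_lt_top hφ)).ne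

theorem WarpBounds.warpedProfileL2_ae_eq (h : WarpBounds D F v C D₁)
    (hφ : IsAdmissibleWindow D F v C φ) {x : ℝ} (hx : x ∈ D) :
    (warpedProfileL2 D F φ x : ℝ → ℂ) =ᵐ[volume] warpedProfile D F φ x := by
  rw [warpedProfileL2, dif_pos (h.memLp_warpedProfile hφ hx)]
  exact MemLp.coeFn_toLp _

theorem WarpBounds.fourier_warpedSystem_ae_eq (h : WarpBounds D F v C D₁)
    (hφ : IsAdmissibleWindow D F v C φ) (p : PhaseSpace D) :
    (𝓕 (warpedSystem D F φ p : L2R) : L2R) =ᵐ[volume]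
      fun t => character p.2 t * warpedProfile D F φ p.1 t := by
  have e : (𝓕 (warpedSystem D F φ p : L2R) : L2R) =
      (ContinuousLinearMap.mul ℂ ℂ).holderL volume ⊤ 2 2
      ((memLp_character p.2).toLp _) (warpedProfileL2 D F φ p.1) := by
    rw [warpedSystem, fourier_translate, FourierTransform.fourier_fourierInv_eq]
  rw [e, ContinuousLinearMap.holderL_apply_apply]
  filter_upwards [(ContinuousLinearMap.mul ℂ ℂ).coeFn_holder (r := 2)
    ((memLp_character p.2).toLp (character p.2)) (warpedProfileL2 D F φ p.1 : L2R),
    (memLp_character p.2).coeFn_toLp, h.warpedProfileL2_ae_eq hφ p.1.2] with t h1 h2 h3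
  rw [h1, h2, h3]
  rfl

theorem WarpBounds.inner_warpedSystem (h : WarpBounds D F v C D₁)
    (hφ : IsAdmissibleWindow D F v C φ) (p : PhaseSpace D) (f : L2R) :
    (inner ℂ (warpedSystem D F φ p : L2R) f : ℂ) =
      ∫ t, star (character p.2 t * warpedProfile D F φ p.1 t) * (𝓕 f : L2R) t := by
  rw [← Lp.inner_fourier_eq, L2.inner_def]
  apply integral_congr_ae
  filter_upwards [h.fourier_warpedSystem_ae_eq hφ p] with t ht
  rw [ht, RCLike.inner_apply, mul_comm]
  rfl

theorem WarpBounds.exists_norm_warpedSystem_le (h : WarpBounds D F v C D₁)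
    (hφ : IsAdmissibleWindow D F v C φ) :
    ∃ B : ℝ, 0 ≤ B ∧ ∀ p, ‖warpedSystem D F φ p‖ ≤ B := by
  set N := ∫⁻ u, ENNReal.ofReal (C * warpWeight D F u) * ‖φ u‖ₑ ^ 2 with hN
  have hNt : N ≠ ⊤ := (h.lintegral_weight_sq_lt_top hφ).ne
  refine ⟨√N.toReal, Real.sqrt_nonneg _, fun p => Real.le_sqrt_of_sq_le ?_⟩
  have e1 : ‖warpedSystem D F φ p‖ = ‖warpedProfileL2 D F φ p.1‖ := by
    have : ‖warpedSystem D F φ p‖ = ‖translate p.2 (𝓕⁻ (warpedProfileL2 D F φ p.1) : L2R)‖ := rfl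
    rw [this, LinearIsometry.norm_map, ← Lp.norm_fourier_eq, FourierTransform.fourier_fourierInv_eq]
  rw [e1]
  have e2 : ENNReal.ofReal (‖warpedProfileL2 D F φ p.1‖ ^ 2) ≤ N := by
    rw [← lintegral_enorm_sq_eq_norm]
    refine le_trans (le_of_eq ?_) (h.lintegral_warpedProfile_sq_le φ p.1.2)
    apply lintegral_congr_ae
    filter_upwards [h.warpedProfileL2_ae_eq hφ p.1.2] with t ht
    rw [ht]
  exact (ENNReal.ofReal_le_iff_le_toReal hNt).1 e2

theorem norm_character (ξ t : ℝ) : ‖character ξ t‖ = 1 := Circle.norm_coe _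

theorem continuous_uncurry_character : Continuous fun p : ℝ × ℝ => character p.1 p.2 := by
  unfold character
  fun_prop

/-- Dominated convergence with majorant `K |𝓕 f|`, integrable because `f` is Schwartz. The factor
`√F'(x)` is pulled out first, since it need not be bounded in `x`. -/
theorem WarpBounds.continuous_inner_schwartz (h : WarpBounds D F v C D₁)
    (hφ : IsAdmissibleWindow D F v C φ) (f : 𝓢(ℝ, ℂ)) :
    Continuous fun p : PhaseSpace D =>
      (inner ℂ (warpedSystem D F φ p : L2R) (f.toLp 2 volume) : ℂ) := by
  obtain ⟨K, hK⟩ := exists_norm_schwartz_le φ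
  have hF := h.warp
  have hFc : Continuous fun p : PhaseSpace D => F p.1 := hF.continuous_restrict.comp continuous_fst
  set G : PhaseSpace D → ℝ → ℂ := fun p =>
    D.indicator fun t => star (character p.2 t * φ (F t - F p.1)) * 𝓕 f t with hG
  have e : ∀ p : PhaseSpace D, (inner ℂ (warpedSystem D F φ p : L2R) (f.toLp 2 volume) : ℂ) =
      ((√(warpWeight D F (F p.1))⁻¹ : ℝ) : ℂ) * ∫ t, G p t := fun p => by
    rw [h.inner_warpedSystem hφ, ← integral_const_mul, SchwartzMap.toLp_fourier_eq]
    apply integral_congr_ae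
    filter_upwards [(𝓕 f).coeFn_toLp 2 volume] with t ht
    rw [ht]
    by_cases htD : t ∈ D
    · simp only [hG, warpedProfile, indicator_of_mem htD, hF.deriv_eq p.1.2, star_mul']
      simp only [RCLike.star_def, Complex.conj_ofReal]
      ring
    · simp [hG, warpedProfile, indicator_of_notMem htD]
  simp only [e]
  refine Continuous.mul ?_ ?_
  · refine Complex.continuous_ofReal.comp (Real.continuous_sqrt.comp ?_)
    exact (h.continuous_weight.comp hFc).inv₀ fun p => (hF.warpWeight_pos _).ne'
  · refine continuous_of_dominated (bound := fun t => K * ‖𝓕 f t‖) (fun p => ?_)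
      (fun p => Eventually.of_forall fun t => ?_) ?_ (Eventually.of_forall fun t => ?_)
    · classical
      simp only [hG]
      rw [← piecewise_eq_indicator]
      refine (ContinuousOn.measurable_piecewise ?_ continuousOn_const
        hF.isOpen.measurableSet).aestronglyMeasurable
      refine ContinuousOn.mul (ContinuousOn.star (ContinuousOn.mul
        (continuous_character _).continuousOn ?_)) (𝓕 f).continuous.continuousOn
      exact φ.continuous.comp_continuousOn (hF.contDiffOn.continuousOn.sub continuousOn_const)
    · have hK0 := (norm_nonneg _).trans (hK 0)
      refine (norm_indicator_le_norm_self _ _).trans ?_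
      rw [norm_mul, norm_star, norm_mul, norm_character, one_mul]
      gcongr
      exact hK _
    · exact ((𝓕 f).integrable.norm).const_mul K
    · by_cases htD : t ∈ D
      · simp only [hG, indicator_of_mem htD]
        have h1 : Continuous fun p : PhaseSpace D => character p.2 t :=
          continuous_uncurry_character.comp (continuous_snd.prodMk continuous_const)
        have h2 : Continuous fun p : PhaseSpace D => φ (F t - F p.1) :=
          φ.continuous.comp (continuous_const.sub hFc)
        exact (h1.mul h2).star.mul continuous_const
      · simp only [hG, indicator_of_notMem htD]
        exact continuous_const

/-- The system is norm bounded, so approximating `f` in `L²` by Schwartz functions approximates its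
transform uniformly. The approximants may leave `fourierL2 D`, so their inner products are taken in
`L2R`. -/
theorem WarpBounds.weaklyContinuous (h : WarpBounds D F v C D₁)
    (hφ : IsAdmissibleWindow D F v C φ) (f : fourierL2 D) :
    Continuous (frameTransform (warpedSystem D F φ) f) := by
  obtain ⟨B, hB0, hB⟩ := h.exists_norm_warpedSystem_le hφ
  have hdense := SchwartzMap.denseRange_toLpCLM (E := ℝ) (F := ℂ) (p := 2)
    (μ := (volume : Measure ℝ)) ENNReal.ofNat_ne_top
  refine continuous_of_uniform_approx_of_continuous fun u hu => ?_
  obtain ⟨ε, hε, hεu⟩ := Metric.mem_uniformity_dist.1 hu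
  obtain ⟨g, hg⟩ := Metric.denseRange_iff.1 hdense (f : L2R) (ε / (B + 1)) (by positivity)
  refine ⟨_, h.continuous_inner_schwartz hφ g, fun p => hεu ?_⟩
  have e : frameTransform (warpedSystem D F φ) f p =
      inner ℂ (warpedSystem D F φ p : L2R) (f : L2R) := rfl
  rw [e, dist_eq_norm, ← inner_sub_right]
  have hg' : ‖(f : L2R) - g.toLp 2 volume‖ < ε / (B + 1) := by
    rw [← dist_eq_norm]
    exact hg
  calc ‖(inner ℂ (warpedSystem D F φ p : L2R) ((f : L2R) - g.toLp 2 volume) : ℂ)‖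
      ≤ ‖(warpedSystem D F φ p : L2R)‖ * ‖(f : L2R) - g.toLp 2 volume‖ := norm_inner_le_norm _ _
    _ ≤ B * (ε / (B + 1)) := by
        gcongr
        exact hB p
    _ < ε := by
        rw [← mul_div_assoc, div_lt_iff₀ (by positivity)]
        nlinarith

/-- For fixed `x` the transform is the Fourier integral at `-ξ` of `conj g_x · 𝓕 f`, which lies in
`L¹` by Cauchy-Schwarz and in `L²` because the profile is bounded. Plancherel applies. -/
theorem WarpBounds.lintegral_frequency (h : WarpBounds D F v C D₁)
    (hφ : IsAdmissibleWindow D F v C φ) (f : fourierL2 D) (x : D) :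
    ∫⁻ ξ, ‖frameTransform (warpedSystem D F φ) f (x, ξ)‖ₑ ^ 2 =
      ∫⁻ t, ‖warpedProfile D F φ x t‖ₑ ^ 2 * ‖(𝓕 (f : L2R) : L2R) t‖ₑ ^ 2 := by
  obtain ⟨K, hK⟩ := exists_norm_schwartz_le φ
  set G : ℝ → ℂ := fun t => star (warpedProfile D F φ x t) * (𝓕 (f : L2R) : L2R) t with hG
  have hprof := h.memLp_warpedProfile hφ x.2
  have hf := Lp.memLp (𝓕 (f : L2R) : L2R)
  have i1 : Integrable G := hprof.star.integrable_mul hf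
  have i2 : MemLp G 2 volume := by
    have hK0 := (norm_nonneg _).trans (hK 0)
    refine hf.of_le_mul (c := √(deriv F x) * K) i1.1 (Eventually.of_forall fun t => ?_)
    rw [hG, norm_mul, norm_star]
    gcongr
    rw [warpedProfile]
    refine (norm_indicator_le_norm_self _ _).trans ?_
    rw [norm_mul, Complex.norm_real, Real.norm_of_nonneg (Real.sqrt_nonneg _)]
    gcongr
    exact hK _
  have e : ∀ ξ, frameTransform (warpedSystem D F φ) f (x, ξ) = 𝓕 G (-ξ) := fun ξ => by
    have e1 : frameTransform (warpedSystem D F φ) f (x, ξ) =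
      inner ℂ (warpedSystem D F φ (x, ξ) : L2R) (f : L2R) := rfl
    rw [e1, h.inner_warpedSystem hφ, Real.fourier_eq]
    congr 1
    ext t
    have e2 : star (character ξ t) = (Real.fourierChar (ξ * t) : ℂ) := by
      rw [character, AddChar.map_neg_eq_inv, Circle.coe_inv_eq_conj, RCLike.star_def,
        Complex.conj_conj]
    have e3 : -inner ℝ t (-ξ) = ξ * t := by simp
    rw [star_mul', e2, e3, Circle.smul_def, smul_eq_mul, hG, mul_assoc]
  simp only [e]
  rw [lintegral_neg_eq_self (μ := volume) (fun ξ => ‖𝓕 G ξ‖ₑ ^ 2), lintegral_enorm_fourier_sq i1 i2]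
  congr 1
  ext t
  rw [hG, enorm_mul, mul_pow]
  congr 2
  rw [← ofReal_norm, norm_star, ofReal_norm]

/-- With `b = F(x)`, the Jacobian `w(b)` cancels `F'(x) = 1 / w(b)`. What remains is `|θ(F(t) -
b)|²`, whose integral over `b` is `‖θ‖²` for every `t`. -/
theorem WarpBounds.tight (h : WarpBounds D F v C D₁)
    (hφ : IsAdmissibleWindow D F v C φ) (f : fourierL2 D) :
    ∫⁻ p, ‖frameTransform (warpedSystem D F φ) f p‖ₑ ^ 2 ∂(phaseMeasure D) =
      ENNReal.ofReal ((∫ s, ‖φ s‖ ^ 2) * ‖f‖ ^ 2) := by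
  have hF := h.warp
  have hpos := hF.warpWeight_pos
  set g : L2R := 𝓕 (f : L2R) with hg
  have hfin : ∫⁻ u, ‖φ u‖ₑ ^ 2 = ENNReal.ofReal (∫ s, ‖φ s‖ ^ 2) := by
    rw [ofReal_integral_eq_lintegral_ofReal ((φ.memLp 2 volume).integrable_norm_pow (by norm_num))
      (Eventually.of_forall fun s => by positivity)]
    congr 1
    ext u
    rw [ENNReal.ofReal_pow (norm_nonneg _), ofReal_norm]
  have hgD : ∀ᵐ t, t ∉ D → g t = 0 := f.2
  have hmg : Measurable fun t => ‖g t‖ₑ ^ 2 :=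
    (Lp.stronglyMeasurable g).measurable.enorm.pow_const 2
  -- Replacing `F` by its indicator gives the measurability needed for Tonelli; values outside `D`
  -- are harmless, since `g` vanishes there.
  have hmφ : Measurable fun q : ℝ × ℝ => ‖φ (D.indicator F q.2 - q.1)‖ₑ ^ 2 :=
    (φ.continuous.measurable.comp
      ((hF.measurable_indicator.comp measurable_snd).sub measurable_fst)).enorm.pow_const 2
  calc ∫⁻ p, ‖frameTransform (warpedSystem D F φ) f p‖ₑ ^ 2 ∂(phaseMeasure D)
      = ∫⁻ b, ENNReal.ofReal (warpWeight D F b) *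
          ∫⁻ t, ‖warpedProfile D F φ (warpInv D F b) t‖ₑ ^ 2 * ‖g t‖ₑ ^ 2 := by
        rw [hF.lintegral_phaseMeasure ((h.weaklyContinuous hφ f).measurable.enorm.pow_const 2)]
        congr 1
        ext b
        rw [h.lintegral_frequency hφ]
    _ = ∫⁻ b, ∫⁻ t, ‖φ (D.indicator F t - b)‖ₑ ^ 2 * ‖g t‖ₑ ^ 2 := by
        congr 1
        ext b
        rw [← lintegral_const_mul' _ _ ENNReal.ofReal_ne_top]
        apply lintegral_congr_ae
        filter_upwards [hgD] with t ht
        by_cases htD : t ∈ D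
        · rw [enorm_warpedProfile_sq hF htD (hF.warpInv_mem b), hF.apply_warpInv,
            indicator_of_mem htD, ← mul_assoc, ← mul_assoc, ← ENNReal.ofReal_mul (hpos b).le,
            mul_inv_cancel₀ (hpos b).ne', ENNReal.ofReal_one, one_mul]
        · simp [ht htD]
    _ = ∫⁻ t, ∫⁻ b, ‖φ (D.indicator F t - b)‖ₑ ^ 2 * ‖g t‖ₑ ^ 2 :=
        lintegral_lintegral_swap (hmφ.mul (hmg.comp measurable_snd)).aemeasurable
    _ = ∫⁻ t, (∫⁻ u, ‖φ u‖ₑ ^ 2) * ‖g t‖ₑ ^ 2 := by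
        congr 1
        ext t
        rw [lintegral_mul_const' _ _ (by simp),
          lintegral_sub_left_eq_self (μ := volume) (fun u => ‖φ u‖ₑ ^ 2)]
    _ = _ := by
        rw [lintegral_const_mul _ hmg, lintegral_enorm_sq_eq_norm, hfin, hg, Lp.norm_fourier_eq,
          ENNReal.ofReal_mul (integral_nonneg fun s => by positivity)]
        rfl

theorem integral_norm_sq_pos (hφ : (φ : ℝ → ℂ) ≠ 0) : 0 < ∫ s, ‖φ s‖ ^ 2 := by
  obtain ⟨x, hx⟩ := Function.ne_iff.1 hφ
  refine integral_pos_of_integrable_nonneg_nonzero (x := x) (φ.continuous.norm.pow 2)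
    ((φ.memLp 2 volume).integrable_norm_pow (by norm_num)) (fun s => by positivity) ?_
  simpa using hx

theorem WarpBounds.isContinuousTightFrame (h : WarpBounds D F v C D₁)
    (hφ : IsAdmissibleWindow D F v C φ) (hne : (φ : ℝ → ℂ) ≠ 0) :
    IsContinuousTightFrame (phaseMeasure D) (warpedSystem D F φ) (∫ s, ‖φ s‖ ^ 2) :=
  ⟨integral_norm_sq_pos hne, h.weaklyContinuous hφ, h.tight hφ⟩

end WarpedFrame

/-! ### Mixed kernels of warped systems -/

section MixedKernel

variable {D : Set ℝ} {F v : ℝ → ℝ} {C D₁ : ℝ} {φ₁ φ₂ : 𝓢(ℝ, ℂ)}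

theorem WarpBounds.inner_warpedSystem_eq (h : WarpBounds D F v C D₁)
    (h₁ : IsAdmissibleWindow D F v C φ₁) (h₂ : IsAdmissibleWindow D F v C φ₂)
    (p q : PhaseSpace D) :
    (inner ℂ (warpedSystem D F φ₁ p) (warpedSystem D F φ₂ q) : ℂ) =
      ((√(warpWeight D F (F p.1))⁻¹ * √(warpWeight D F (F q.1))⁻¹ : ℝ) : ℂ) *
        ∫ s, windowProduct φ₁ φ₂ (F p.1) (F q.1) s * warpWeight D F s *
          warpedCharacter D F (p.2 - q.2) s := by
  have hF := h.warp
  rw [Submodule.coe_inner, h.inner_warpedSystem h₁]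
  set G : ℝ → ℂ := fun t => star (character p.2 t * warpedProfile D F φ₁ p.1 t) *
    (character q.2 t * warpedProfile D F φ₂ q.1 t) with hG
  have e1 : ∫ t, star (character p.2 t * warpedProfile D F φ₁ p.1 t) *
      (𝓕 (warpedSystem D F φ₂ q : L2R) : L2R) t = ∫ t, G t := by
    apply integral_congr_ae
    filter_upwards [h.fourier_warpedSystem_ae_eq h₂ q] with t ht
    rw [ht]
  have e2 : ∫ t, G t = ∫ t in D, G t := by
    refine (setIntegral_eq_integral_of_forall_compl_eq_zero fun t ht => ?_).symm
    simp [hG, warpedProfile, indicator_of_notMem ht]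
  rw [e1, e2, hF.integral_eq, ← integral_const_mul]
  congr 1
  ext s
  have hs := hF.warpInv_mem s
  have e3 : star (character p.2 (warpInv D F s)) * character q.2 (warpInv D F s) =
      warpedCharacter D F (p.2 - q.2) s := by
    have e4 : star (character p.2 (warpInv D F s)) =
        (Real.fourierChar (p.2 * warpInv D F s) : ℂ) := by
      rw [character, AddChar.map_neg_eq_inv, Circle.coe_inv_eq_conj, RCLike.star_def,
        Complex.conj_conj]
    rw [e4, character, warpedCharacter, ← Circle.coe_mul, ← AddChar.map_add_eq_mul]
    congr 2
    ring
  rw [← e3]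
  simp only [hG, warpedProfile, indicator_of_mem hs, hF.apply_warpInv, hF.deriv_eq p.1.2,
    hF.deriv_eq q.1.2, windowProduct, star_mul', Complex.ofReal_mul]
  simp only [RCLike.star_def, Complex.conj_ofReal]
  ring

/-- The left side is `√(w(b) / w(a))`, and `x ≤ 1 + x²` avoids a square root in the bound. -/
theorem WarpBounds.weight_mul_sqrt_le (h : WarpBounds D F v C D₁) (a b : ℝ) :
    warpWeight D F b * (√(warpWeight D F a)⁻¹ * √(warpWeight D F b)⁻¹) ≤
      1 + C * warpWeight D F (b - a) := by
  have ha := h.warp.warpWeight_pos a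
  have hb := h.warp.warpWeight_pos b
  have h1 := h.weight_ratio_le a b
  set x := √(warpWeight D F b * (warpWeight D F a)⁻¹) with hx
  have hx2 : x ^ 2 = warpWeight D F b * (warpWeight D F a)⁻¹ := Real.sq_sqrt (by positivity)
  have e : warpWeight D F b * (√(warpWeight D F a)⁻¹ * √(warpWeight D F b)⁻¹) = x := by
    have e1 : warpWeight D F b * √(warpWeight D F b)⁻¹ = √(warpWeight D F b) := by
      rw [Real.sqrt_inv]
      nth_rewrite 1 [← Real.mul_self_sqrt hb.le]
      rw [mul_inv_cancel_right₀ (Real.sqrt_pos.2 hb).ne']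
    rw [hx, Real.sqrt_mul hb.le, ← e1]
    ring
  rw [e]
  nlinarith [sq_nonneg (x - 1)]

/-- In the coordinates `(b, ω)` the Jacobian `w(b)` and the normalizations combine into a function
of `b - a`, as does the bound on `m`. The frequency integral is then the oscillatory estimate, and
the `b`-integral the convolution estimate. -/
theorem WarpBounds.hasFiniteRows (h : WarpBounds D F v C D₁)
    (h₁ : IsAdmissibleWindow D F v C φ₁) (h₂ : IsAdmissibleWindow D F v C φ₂)
    {m : PhaseSpace D → PhaseSpace D → ℝ} (hm : IsKernelWeight m) {c : ℝ}
    (hc : ∀ p q, m p q ≤ c * v (F q.1 - F p.1)) :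
    HasFiniteRows (phaseMeasure D) m (warpedSystem D F φ₁) (warpedSystem D F φ₂) := by
  have hF := h.warp
  have hpos := hF.warpWeight_pos
  have hD := h.const_nonneg
  have hfin : ∀ {φ : 𝓢(ℝ, ℂ)}, IsAdmissibleWindow D F v C φ →
      ∫⁻ u, ENNReal.ofReal (dominatingWeight D F v C u * jetNorm φ u) < ⊤ := fun {φ} hφ => by
    rw [← ofReal_integral_eq_lintegral_ofReal hφ (Eventually.of_forall fun u =>
      mul_nonneg (h.dominatingWeight_nonneg u) (jetNorm_nonneg φ u))]
    exact ENNReal.ofReal_lt_top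
  set N := fun φ : 𝓢(ℝ, ℂ) => ∫⁻ u, ENNReal.ofReal (dominatingWeight D F v C u * jetNorm φ u)
  refine ⟨ENNReal.ofReal c * ENNReal.ofReal (Real.pi * (3 + D₁)) * (N φ₁ * N φ₂),
    ENNReal.mul_ne_top (ENNReal.mul_ne_top ENNReal.ofReal_ne_top ENNReal.ofReal_ne_top)
      (ENNReal.mul_ne_top (hfin h₁).ne (hfin h₂).ne), fun p => ?_⟩
  have hmeas : Measurable fun q =>
      ‖(inner ℂ (warpedSystem D F φ₁ p) (warpedSystem D F φ₂ q) : ℂ)‖ₑ *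
        ENNReal.ofReal (m p q) := by
    have e : ∀ q, ‖(inner ℂ (warpedSystem D F φ₁ p) (warpedSystem D F φ₂ q) : ℂ)‖ₑ =
        ‖frameTransform (warpedSystem D F φ₂) (warpedSystem D F φ₁ p) q‖ₑ := fun q =>
      enorm_inner_symm _ _
    simp only [e, hm.symm p]
    exact (h.weaklyContinuous h₂ _).measurable.enorm.mul (hm.measurable p).ennreal_ofReal
  rw [hF.lintegral_phaseMeasure hmeas]
  set a := F p.1 with ha
  set I := fun b η => ∫ s, windowProduct φ₁ φ₂ a b s * warpWeight D F s *
    warpedCharacter D F η s with hI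
  have hinner : ∀ b ω, ENNReal.ofReal (warpWeight D F b) *
      (‖(inner ℂ (warpedSystem D F φ₁ p)
        (warpedSystem D F φ₂ (⟨warpInv D F b, hF.warpInv_mem b⟩, ω)) : ℂ)‖ₑ *
        ENNReal.ofReal (m p (⟨warpInv D F b, hF.warpInv_mem b⟩, ω))) ≤
      ENNReal.ofReal c * (ENNReal.ofReal (v (b - a) * (1 + C * warpWeight D F (b - a))) *
        ‖I b (p.2 - ω)‖ₑ) := by
    intro b ω
    set r := √(warpWeight D F a)⁻¹ * √(warpWeight D F b)⁻¹ with hr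
    have hr0 : 0 ≤ r := by positivity
    have hc' := hc p (⟨warpInv D F b, hF.warpInv_mem b⟩, ω)
    simp only [hF.apply_warpInv] at hc'
    have hm0 := (hm.pos p (⟨warpInv D F b, hF.warpInv_mem b⟩, ω)).le
    have hv := zero_le_one.trans (h.one_le (b - a))
    -- The sign of `c` is forced by `0 < m` and `1 ≤ v`.
    have hc0 : 0 ≤ c := by
      by_contra hneg
      have := h.one_le (b - a)
      nlinarith
    rw [h.inner_warpedSystem_eq h₁ h₂, enorm_mul, enorm_complex_ofReal]
    simp only [hF.apply_warpInv]
    rw [← ha, ← hr, Real.enorm_of_nonneg hr0]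
    calc ENNReal.ofReal (warpWeight D F b) * (ENNReal.ofReal r * ‖I b (p.2 - ω)‖ₑ *
          ENNReal.ofReal (m p (⟨warpInv D F b, hF.warpInv_mem b⟩, ω)))
        = ENNReal.ofReal (warpWeight D F b * r *
          m p (⟨warpInv D F b, hF.warpInv_mem b⟩, ω)) * ‖I b (p.2 - ω)‖ₑ := by
          rw [ENNReal.ofReal_mul (mul_nonneg (hpos b).le hr0), ENNReal.ofReal_mul (hpos b).le]
          ring
      _ ≤ ENNReal.ofReal (c * (v (b - a) * (1 + C * warpWeight D F (b - a)))) *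
          ‖I b (p.2 - ω)‖ₑ := by
          refine mul_le_mul_left (ENNReal.ofReal_le_ofReal ?_) _
          have h3 := mul_pos h.const_pos (hpos (b - a))
          calc warpWeight D F b * r * m p (⟨warpInv D F b, hF.warpInv_mem b⟩, ω)
              ≤ (1 + C * warpWeight D F (b - a)) * (c * v (b - a)) :=
                mul_le_mul (h.weight_mul_sqrt_le a b) hc' hm0 (by linarith)
            _ = _ := by ring
      _ = _ := by rw [ENNReal.ofReal_mul hc0, mul_assoc]
  calc ∫⁻ b, ENNReal.ofReal (warpWeight D F b) *
        ∫⁻ ω, ‖(inner ℂ (warpedSystem D F φ₁ p)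
          (warpedSystem D F φ₂ (⟨warpInv D F b, hF.warpInv_mem b⟩, ω)) : ℂ)‖ₑ *
          ENNReal.ofReal (m p (⟨warpInv D F b, hF.warpInv_mem b⟩, ω))
      ≤ ∫⁻ b, ENNReal.ofReal c * (ENNReal.ofReal (v (b - a) * (1 + C * warpWeight D F (b - a))) *
        ∫⁻ η, ‖I b η‖ₑ) := by
        refine lintegral_mono fun b => ?_
        rw [← lintegral_const_mul' _ _ ENNReal.ofReal_ne_top,
          ← lintegral_sub_left_eq_self (μ := volume) (fun η => ‖I b η‖ₑ) p.2,
          ← lintegral_const_mul' _ _ ENNReal.ofReal_ne_top,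
          ← lintegral_const_mul' _ _ ENNReal.ofReal_ne_top]
        exact lintegral_mono fun ω => hinner b ω
    _ ≤ ∫⁻ b, ENNReal.ofReal c * (ENNReal.ofReal (Real.pi * (3 + D₁)) *
        (ENNReal.ofReal (v (b - a) * (1 + C * warpWeight D F (b - a))) *
        ∫⁻ s, ENNReal.ofReal (productBound D F C φ₁ φ₂ a b s))) := by
        refine lintegral_mono fun b => ?_
        rw [mul_left_comm (ENNReal.ofReal (Real.pi * (3 + D₁)))]
        gcongr
        exact h.lintegral_oscillatory_window_le h₁ a b
    _ ≤ _ := by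
        rw [lintegral_const_mul' _ _ ENNReal.ofReal_ne_top,
          lintegral_const_mul' _ _ ENNReal.ofReal_ne_top, mul_assoc]
        gcongr
        exact h.lintegral_productBound_le φ₁ φ₂ a

end MixedKernel

/-! ### The ratio weight on phase space -/

section RatioWeight

variable {D : Set ℝ} {F m₁ v₁ : ℝ → ℝ}

theorem isKernelWeight_ratioWeight (hF : IsWarpingFunction D F)
    (hm : IsWeight (m₁ ∘ warpInv D F)) : IsKernelWeight (ratioWeight (D := D) m₁) := by
  -- Positivity and measurability are known only for `m₁ ∘ F⁻¹`; composing with `F` transfers them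
  -- to `m₁` on `D`.
  have hval : ∀ x : D, m₁ x = (m₁ ∘ warpInv D F) (F x) := fun x => by
    rw [Function.comp_apply, hF.warpInv_apply x.2]
  have hpos : ∀ x : D, 0 < m₁ x := fun x => by
    rw [hval]
    exact hm.2 _
  have hmeas : Measurable fun p : PhaseSpace D => m₁ p.1 := by
    simp only [hval]
    exact hm.1.comp (hF.continuous_restrict.measurable.comp measurable_fst)
  refine ⟨fun p q => ?_, fun p q => max_comm _ _, fun p q r => ?_, fun q => ?_⟩
  · exact lt_max_of_lt_left (div_pos (hpos _) (hpos _))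
  · have hp := hpos p.1
    have hq := hpos q.1
    have hr := hpos r.1
    have hpq : 0 ≤ m₁ p.1 / m₁ q.1 := by positivity
    have hqp : 0 ≤ m₁ q.1 / m₁ p.1 := by positivity
    have hqr : 0 ≤ m₁ q.1 / m₁ r.1 := by positivity
    have hrq : 0 ≤ m₁ r.1 / m₁ q.1 := by positivity
    refine max_le ?_ ?_
    · rw [← div_mul_div_cancel₀ hq.ne' (a := m₁ p.1) (c := m₁ r.1)]
      exact mul_le_mul (le_max_left _ _) (le_max_left _ _) hqr (hpq.trans (le_max_left _ _))
    · rw [← div_mul_div_cancel₀ hq.ne' (a := m₁ r.1) (c := m₁ p.1), mul_comm]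
      exact mul_le_mul (le_max_right _ _) (le_max_right _ _) hrq (hpq.trans (le_max_left _ _))
  · exact (hmeas.div_const _).max (measurable_const.div hmeas)

/-- Moderateness at the increment `F(x) - F(y)` bounds one ratio; symmetry of `v₁` bounds its
reciprocal by the same quantity. -/
theorem exists_ratioWeight_le (hF : IsWarpingFunction D F) (hsymm : ∀ x, v₁ (-x) = v₁ x)
    (hmod : IsModerate v₁ (m₁ ∘ warpInv D F)) :
    ∃ c : ℝ, ∀ p q : PhaseSpace D, ratioWeight m₁ p q ≤ c * v₁ (F q.1 - F p.1) := by
  obtain ⟨-, hw, c, hc⟩ := hmod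
  have hle : ∀ x y : D, m₁ x / m₁ y ≤ c * v₁ (F x - F y) := fun x y => by
    have h1 := hc (F x - F y) (F y)
    have h2 := hw.2 (F y)
    rw [sub_add_cancel] at h1
    simp only [Function.comp_apply, hF.warpInv_apply x.2, hF.warpInv_apply y.2] at h1 h2
    rwa [div_le_iff₀ h2]
  refine ⟨c, fun p q => max_le ?_ (hle q.1 p.1)⟩
  rw [← hsymm, neg_sub]
  exact hle p.1 q.1

end RatioWeight

/-! ### Specialization to warped systems -/

section Main

variable {D : Set ℝ} {F v : ℝ → ℝ} {C D₁ : ℝ} {φ₁ φ₂ : 𝓢(ℝ, ℂ)}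

theorem WarpBounds.admitsCoorbits (h : WarpBounds D F v C D₁)
    (hφ : IsAdmissibleWindow D F v C φ₁) (hne : (φ₁ : ℝ → ℂ) ≠ 0)
    {m : PhaseSpace D → PhaseSpace D → ℝ} (hm : IsKernelWeight m) {c : ℝ}
    (hc : ∀ p q, m p q ≤ c * v (F q.1 - F p.1)) : AdmitsCoorbits D F m φ₁ := by
  have hrows := h.hasFiniteRows hφ hφ hm hc
  have hcont := h.weaklyContinuous hφ
  exact ⟨fun x hx => h.memLp_warpedProfile hφ hx, h.isContinuousTightFrame hφ hne,
    hrows.memKernelAlgebra hm hcont hcont hrows _, fun z p => hrows.mem_testSpace hm hcont z p⟩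

theorem WarpBounds.generateSameCoorbits (h : WarpBounds D F v C D₁)
    (h₁ : IsAdmissibleWindow D F v C φ₁) (h₂ : IsAdmissibleWindow D F v C φ₂)
    (hne₁ : (φ₁ : ℝ → ℂ) ≠ 0) (hne₂ : (φ₂ : ℝ → ℂ) ≠ 0)
    {m : PhaseSpace D → PhaseSpace D → ℝ} (hm : IsKernelWeight m) {c : ℝ}
    (hc : ∀ p q, m p q ≤ c * v (F q.1 - F p.1)) :
    GenerateSameCoorbits (phaseMeasure D) m (warpedSystem D F φ₁) (warpedSystem D F φ₂) := by
  have := h.warp.sigmaFinite_phaseMeasure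
  exact generateSameCoorbits_of_hasFiniteRows hm (h.isContinuousTightFrame h₁ hne₁)
    (h.isContinuousTightFrame h₂ hne₂) (h.hasFiniteRows h₁ h₁ hm hc)
    (h.hasFiniteRows h₁ h₂ hm hc) (h.hasFiniteRows h₂ h₁ hm hc) (h.hasFiniteRows h₂ h₂ hm hc)

end Main

end WarpedCoorbit

end

open WarpedCoorbit in
theorem mainTheorem12
    (D : Set ℝ) (F : ℝ → ℝ) (hF : IsWarpingFunction D F)
    (hw : ContDiff ℝ 1 (warpWeight D F))
    (hsub : ∃ C : ℝ, ∀ x y, warpWeight D F (x + y) / (warpWeight D F x * warpWeight D F y) ≤ C)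
    (hder : ∃ D₁ : ℝ, ∀ x, |deriv (warpWeight D F) x / warpWeight D F x| ≤ D₁)
    (m₁ v₁ : ℝ → ℝ) (hsymm : ∀ x, v₁ (-x) = v₁ x)
    (hmod : IsModerate v₁ (m₁ ∘ warpInv D F))
    (θ₁ θ₂ : ℝ → ℂ) (hθ₁ : θ₁ ≠ 0) (hθ₂ : θ₂ ≠ 0)
    (hclass : (IsTestFunction θ₁ ∧ IsTestFunction θ₂) ∨
      (PolynomialGrowth (warpWeight D F) ∧ PolynomialGrowth v₁ ∧
        IsSchwartz θ₁ ∧ IsSchwartz θ₂)) :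
    AdmitsCoorbits D F (ratioWeight m₁) θ₁ ∧ AdmitsCoorbits D F (ratioWeight m₁) θ₂ ∧
    GenerateSameCoorbits (phaseMeasure D) (ratioWeight m₁)
      (warpedSystem D F θ₁) (warpedSystem D F θ₂) := by
  obtain ⟨C, D₁, h⟩ := hF.exists_warpBounds hw hsub hder hsymm hmod.1
  have hm := isKernelWeight_ratioWeight hF hmod.2.1
  obtain ⟨c, hc⟩ := exists_ratioWeight_le hF hsymm hmod
  -- Both classes of windows consist of Schwartz functions; the alternatives differ only in the
  -- reason for admissibility.
  obtain ⟨φ₁, φ₂, rfl, rfl, h₁, h₂⟩ : ∃ φ₁ φ₂ : 𝓢(ℝ, ℂ), ⇑φ₁ = θ₁ ∧ ⇑φ₂ = θ₂ ∧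
      IsAdmissibleWindow D F v₁ C φ₁ ∧ IsAdmissibleWindow D F v₁ C φ₂ := by
    rcases hclass with ⟨⟨hs₁, hk₁⟩, hs₂, hk₂⟩ | ⟨hpw, hpv, ⟨φ₁, rfl⟩, φ₂, rfl⟩
    · exact ⟨hk₁.toSchwartzMap hs₁, hk₂.toSchwartzMap hs₂, rfl, rfl,
        h.isAdmissibleWindow_of_hasCompactSupport hk₁,
        h.isAdmissibleWindow_of_hasCompactSupport hk₂⟩
    · exact ⟨φ₁, φ₂, rfl, rfl, h.isAdmissibleWindow_of_polynomialGrowth hpw hpv φ₁,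
        h.isAdmissibleWindow_of_polynomialGrowth hpw hpv φ₂⟩
  exact ⟨h.admitsCoorbits h₁ hθ₁ hm hc, h.admitsCoorbits h₂ hθ₂ hm hc,
    h.generateSameCoorbits h₁ h₂ hθ₁ hθ₂ hm hc⟩
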